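/- Let $P_k=\mathbb F_2[x_1,\dots,x_k]$ with $\deg x_j=1$, considered as a module over the mod-2 Steenrod algebra $\mathcal A$ (so $Sq^0x_j=x_j$, $Sq^1x_j=x_j^2$, $Sq^ix_j=0$ for $i>1$, and the Cartan formula holds). Let $\mathcal A^+$ be the augmentation ideal of $\mathcal A$, let $QP_k=P_k/\mathcal A^+P_k$, and write $[f]$ for the class of $f$ in $QP_k$. Let $\alpha_i(a)$ denote the $i$-th binary digit of $a\ge 0$ and, for a monomial $x=x_1^{a_1}\cdots x_k^{a_k}$, let $\nu_j(x)=a_j$, $\sigma(x)=(a_1,\dots,a_k)$ and $\omega(x)=(\omega_1(x),\omega_2(x),\dots)$ with $\omega_i(x)=\sum_j\alpha_{i-1}(a_j)$. Sequences are ordered by the left lexicographical order. For monomials $x,y$ of the same degree, $x<y$ means that $\omega(x)<\omega(y)$, or $\omega(x)=\omega(y)$ and $\sigma(x)<\sigma(y)$. A monomial $x$ is inadmissible if $x-\sum_{j=1}^t y_j\in\mathcal A^+P_k$ for some (possibly no) monomials $y_1,\dots,y_t<x$ of the same degree as $x$, and admissible otherwise. For a sequence $\omega=(\omega_1,\omega_2,\dots)$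 of non-negative integers, almost all zero, let $\deg\omega=\sum_{i>0}2^{i-1}\omega_i$. Let $P_k(\omega)$ be the span of the monomials $y$ with $\deg y=\deg\omega$ and $\omega(y)\le\omega$, let $P_k^-(\omega)$ be the span of those with moreover $\omega(y)<\omega$, and let $B_k(\omega)$ be the set of admissible monomials in $P_k(\omega)$. Let $QP_k(\omega)=P_k(\omega)/((\mathcal A^+P_k\cap P_k(\omega))+P_k^-(\omega))$, with $[f]_\omega$ the class of $f\in P_k(\omega)$; it is identified with the subspace $QP_k^\omega$ of $QP_k$ spanned by the classes $[x]$ of the admissible monomials $x$ with $\omega(x)=\omega$. Let $P_k^+$ be the span of the monomials $x_1^{a_1}\cdots x_k^{a_k}$ with all $a_j>0$, let $QP_k^+$ be its image in $QP_k$, and let $QP_k^+(\omega)=QP_k^\omega\cap QP_k^+$. In $QP_k(\omega)$ this subspace corresponds to the image of $P_k(\omega)\cap P_k^+$. Let $1\le i<i_1<\dots<i_r\le k$ with $r\geq 1$, and $I=(i_1,\dots,i_r)$. A monomial $x\in P_{k-1}$ is $u$-compatible with $(i;I)$, where $1\le u\le r$, if $\nu_{i_t-1}(x)=2^r-1$ for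 $1\le t<u$, $\nu_{i_u-1}(x)>2^r-1$, $\alpha_{r-t}(\nu_{i_u-1}(x))=1$ for $1\le t\le u$, and $\alpha_{r-t}(\nu_{i_t-1}(x))=1$ for $u<t\le r$; there is at most one such $u$. Let $f_i:P_{k-1}\to P_k$ be the algebra homomorphism with $f_i(x_j)=x_j$ for $j<i$ and $f_i(x_j)=x_{j+1}$ for $j\ge i$. If $x$ is $u$-compatible with $(i;I)$ for some $u$, put $$\phi_{(i;I)}(x)=\frac{x_i^{2^r-1}f_i(x)}{x_{i_u}^{2^{r-1}+\dots+2^{r-u}}\prod_{u<t\le r}x_{i_t}^{2^{r-t}}},$$ and otherwise put $\phi_{(i;I)}(x)=0$. For a set $B$ of monomials of $P_{k-1}$, let $\Phi^+(B)$ be the set of all monomials $\phi_{(i;I)}(x)\ne0$, with $x\in B$ and $(i;I)$ as above, in which every variable $x_1,\dots,x_k$ occurs. Let $\bar\omega=\bar\omega_{(5,3)}=(4,4,2,1)$, a weight vector of degree $28$, and let $C$ be the set of the 19 monomials $x_1^{a_1}x_2^{a_2}x_3^{a_3}x_4^{a_4}x_5^{a_5}$ with exponents $(a_1,\dots,a_5)$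 equal to $(7,9,2,3,7)$, $(7,9,2,7,3)$, $(7,9,3,2,7)$, $(7,9,3,7,2)$, $(7,9,7,2,3)$, $(7,9,7,3,2)$, $(3,7,11,4,3)$, $(7,3,11,4,3)$, $(7,11,3,4,3)$, $(7,9,3,3,6)$, $(7,9,3,6,3)$, $(3,7,7,8,3)$, $(3,7,8,3,7)$, $(3,7,8,7,3)$, $(7,3,7,8,3)$, $(7,3,8,3,7)$, $(7,3,8,7,3)$, $(7,7,3,8,3)$, $(7,7,8,3,3)$. **Proposition.** The set $S=\Phi^+(B_4(\bar\omega))\cup C$ consists of exactly $355$ monomials, and the classes $[x]$, $x\in S$, are pairwise distinct and form a basis of the $\mathbb F_2$-vector space $QP_5^+(\bar\omega)\subset QP_5$. Likewise $S\subset P_5(\bar\omega)$, and the classes $[x]_{\bar\omega}$, $x\in S$, are pairwise distinct and form a basis of the image of $P_5(\bar\omega)\cap P_5^+$ in $QP_5(\bar\omega)$. -/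

import Mathlib

namespace HitProblem

noncomputable section

/-! ## The polynomial algebra and the action of the Steenrod algebra -/

/-- `P k` is the polynomial algebra `F_2[x_1, …, x_k]`; the variables are indexed from `0`. -/
abbrev P (k : ℕ) : Type := MvPolynomial (Fin k) (ZMod 2)

/-- A monomial of `P k`, given by its exponent vector. -/
abbrev Mon (k : ℕ) : Type := Fin k →₀ ℕ

/-- The monomial as an element of `P k`. -/
def toPoly {k : ℕ} (a : Mon k) : P k := MvPolynomial.monomial a 1

/-- The total Steenrod square `P k → P k [T]`, `f ↦ ∑ i, Sq^i(f) T^i`: the algebra homomorphism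
(Cartan formula) with `x_j ↦ x_j + x_j^2 T`
(that is, `Sq^0 x_j = x_j`, `Sq^1 x_j = x_j^2` and `Sq^i x_j = 0` for `i > 1`). -/
def totalSq (k : ℕ) : P k →ₐ[ZMod 2] Polynomial (P k) :=
  MvPolynomial.aeval fun j : Fin k =>
    Polynomial.C (MvPolynomial.X j) + Polynomial.C (MvPolynomial.X j ^ 2) * Polynomial.X

/-- The Steenrod square `Sq^i` on `P k`. -/
def Sq (k i : ℕ) : Module.End (ZMod 2) (P k) :=
  ((Polynomial.lcoeff (P k) i).restrictScalars (ZMod 2)).comp (totalSq k).toLinearMap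

/-- The operators on `P k` given by the elements of the augmentation ideal `A^+` of the mod 2
Steenrod algebra: the non-unital algebra generated by the `Sq^i` with `i > 0`. -/
def augmentationIdeal (k : ℕ) : NonUnitalSubalgebra (ZMod 2) (Module.End (ZMod 2) (P k)) :=
  NonUnitalAlgebra.adjoin (ZMod 2) {θ | ∃ i : ℕ, 0 < i ∧ θ = Sq k i}

/-- The space `A^+ P_k` of hit polynomials. -/
def hit (k : ℕ) : Submodule (ZMod 2) (P k) :=
  Submodule.span (ZMod 2) {g | ∃ θ ∈ augmentationIdeal k, ∃ f : P k, g = θ f}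

/-- `QP_k = P_k / A^+ P_k`. -/
abbrev QP (k : ℕ) : Type := P k ⧸ hit k

/-! ## Weight vectors, the order on monomials, admissible monomials -/

/-- `α_i(a)`: the `i`-th binary digit of `a`. -/
def alpha (i a : ℕ) : ℕ := a / 2 ^ i % 2

/-- The weight vector `ω(x)`; the entry of index `i` here is
`ω_{i+1}(x) = ∑ j, α_i(ν_j(x))`. -/
def weight {k : ℕ} (a : Mon k) : ℕ →₀ ℕ :=
  Finsupp.onFinset (Finset.range (a.degree + 1)) (fun i => ∑ j : Fin k, alpha i (a j)) (by
    intro i hi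
    by_contra hlt
    apply hi
    refine Finset.sum_eq_zero fun j _ => ?_
    have h1 : a j ≤ a.degree := Finsupp.le_degree j a
    have h2 : i < 2 ^ i := Nat.lt_two_pow_self
    rw [Finset.mem_range] at hlt
    have h3 : a j < 2 ^ i := by omega
    simp [alpha, Nat.div_eq_of_lt h3])

/-- `deg ω = ∑_{i > 0} 2^{i-1} ω_i` (entries indexed from `0` here). -/
def weightDegree (ω : ℕ →₀ ℕ) : ℕ := ω.sum fun i w => 2 ^ i * w

/-- The order on monomials of the same degree: compare weight vectors, then exponent vectors,
both in the left lexicographical order. -/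
def monLT {k : ℕ} (a b : Mon k) : Prop :=
  toLex (weight a) < toLex (weight b) ∨ (weight a = weight b ∧ toLex a < toLex b)

/-- `a` is congruent modulo hit polynomials to a (possibly empty) sum of smaller monomials
of the same degree. -/
def Inadmissible {k : ℕ} (a : Mon k) : Prop :=
  ∃ Y : Finset (Mon k), (∀ b ∈ Y, b.degree = a.degree ∧ monLT b a) ∧
    toPoly a - ∑ b ∈ Y, toPoly b ∈ hit k

def Admissible {k : ℕ} (a : Mon k) : Prop := ¬ Inadmissible a

/-! ## The spaces attached to a weight vector -/

/-- The monomials spanning `P_k(ω)`. -/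
def monLE (k : ℕ) (ω : ℕ →₀ ℕ) : Set (Mon k) :=
  {a | a.degree = weightDegree ω ∧ toLex (weight a) ≤ toLex ω}

/-- `P_k(ω)`. -/
def PLE (k : ℕ) (ω : ℕ →₀ ℕ) : Submodule (ZMod 2) (P k) :=
  Submodule.span (ZMod 2) (toPoly '' monLE k ω)

/-- `P_k^-(ω)`. -/
def PLT (k : ℕ) (ω : ℕ →₀ ℕ) : Submodule (ZMod 2) (P k) :=
  Submodule.span (ZMod 2) (toPoly '' {a ∈ monLE k ω | toLex (weight a) < toLex ω})

/-- `P_k^+`, spanned by the monomials in which every variable occurs. -/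
def PPlus (k : ℕ) : Submodule (ZMod 2) (P k) :=
  Submodule.span (ZMod 2) (toPoly '' {a : Mon k | ∀ j, 0 < a j})

/-- The denominator `(A^+ P_k ∩ P_k(ω)) + P_k^-(ω)`, as a subspace of `P_k(ω)`. -/
def QDenom (k : ℕ) (ω : ℕ →₀ ℕ) : Submodule (ZMod 2) (PLE k ω) :=
  ((hit k ⊓ PLE k ω) ⊔ PLT k ω).comap (PLE k ω).subtype

/-- `QP_k(ω) = P_k(ω) / ((A^+ P_k ∩ P_k(ω)) + P_k^-(ω))`. -/
abbrev QPQuot (k : ℕ) (ω : ℕ →₀ ℕ) : Type := PLE k ω ⧸ QDenom k ω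

/-- The image of `P_k(ω) ∩ P_k^+` in the quotient `QP_k(ω)`. -/
def QPQuotPlus (k : ℕ) (ω : ℕ →₀ ℕ) : Submodule (ZMod 2) (QPQuot k ω) :=
  ((PPlus k).comap (PLE k ω).subtype).map (QDenom k ω).mkQ

/-- `QP_k^ω`: the subspace of `QP_k` spanned by the classes of the admissible monomials of
weight vector `ω`; it is identified with `QP_k(ω)`. -/
def QPSub (k : ℕ) (ω : ℕ →₀ ℕ) : Submodule (ZMod 2) (QP k) :=
  Submodule.span (ZMod 2) {q | ∃ a : Mon k, Admissible a ∧ weight a = ω ∧ q = (hit k).mkQ (toPoly a)}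

/-- `QP_k^+`, as a subspace (a direct summand) of `QP_k`. -/
def QPPlus (k : ℕ) : Submodule (ZMod 2) (QP k) := (PPlus k).map (hit k).mkQ

/-- `QP_k^+(ω) = QP_k(ω) ∩ QP_k^+`, where `QP_k(ω)` is identified with `QP_k^ω ⊆ QP_k`. -/
def QPPlusSub (k : ℕ) (ω : ℕ →₀ ℕ) : Submodule (ZMod 2) (QP k) := QPSub k ω ⊓ QPPlus k

/-- `B_k(ω)`: the admissible monomials in `P_k(ω)`. -/
def B (k : ℕ) (ω : ℕ →₀ ℕ) : Set (Mon k) := {a ∈ monLE k ω | Admissible a}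

/-- The weight vector `((k-1)^{(b-1)}, k-3, 1)`, for `k ≥ 3` and `b ≥ 1`. -/
def omegaBar (k b : ℕ) : ℕ →₀ ℕ :=
  (∑ i ∈ Finset.range (b - 1), Finsupp.single i (k - 1)) + Finsupp.single (b - 1) (k - 3)
    + Finsupp.single b 1

/-! ## The maps `φ_{(i;I)}` and the set `Φ^+(B)` -/

/-- An element `(i; I)` of `N_k`, `I = (i_1 < … < i_r)` with `i < i_1`
(then `r < k` holds automatically). -/
structure NIndex (k : ℕ) where
  i : Fin k
  r : ℕ
  I : Fin r → Fin k
  strictMono : StrictMono I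
  lt : ∀ t, i < I t

/-- `ν_{i_t - 1}(x)` for a monomial `x` in `P_{k-1}`, where `k = n + 1`. -/
def nuPred {n : ℕ} (N : NIndex (n + 1)) (x : Mon n) (t : Fin N.r) : ℕ :=
  x ((N.I t).pred (Fin.ne_zero_of_lt (N.lt t)))

/-- `x` is `u`-compatible with `(i; I)`, for `r = ℓ(I) > 0`.
As `t` and `u` run from `0` here, `r - t` becomes `r - 1 - t`. -/
def Compatible {n : ℕ} (N : NIndex (n + 1)) (x : Mon n) (u : Fin N.r) : Prop :=
  (∀ t < u, nuPred N x t = 2 ^ N.r - 1) ∧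
  2 ^ N.r - 1 < nuPred N x u ∧
  (∀ t ≤ u, alpha (N.r - 1 - t) (nuPred N x u) = 1) ∧
  (∀ t, u < t → alpha (N.r - 1 - t) (nuPred N x t) = 1)

/-- The exponent vector of
`x_{(I,u)} = x_{i_u}^{2^{r-1} + … + 2^{r-u}} ∏_{u < t ≤ r} x_{i_t}^{2^{r-t}}`. -/
def xIu {n : ℕ} (N : NIndex (n + 1)) (u : Fin N.r) : Mon (n + 1) :=
  Finsupp.single (N.I u) (∑ t ∈ Finset.Iic u, 2 ^ (N.r - 1 - (t : ℕ)))
    + ∑ t ∈ Finset.Ioi u, Finsupp.single (N.I t) (2 ^ (N.r - 1 - (t : ℕ)))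

/-- `f_i(x)` for a monomial `x`: `x_j ↦ x_j` for `j < i` and `x_j ↦ x_{j+1}` for `j ≥ i`. -/
def fMon {n : ℕ} (i : Fin (n + 1)) (x : Mon n) : Mon (n + 1) :=
  Finsupp.mapDomain i.succAbove x

open Classical in
/-- `φ_{(i;I)}(x)` for a monomial `x`; the value `none` stands for the zero polynomial.
There is at most one `u` with which `x` is `u`-compatible, and the monomial `x_{(I,u)}`
then divides `x_i^{2^r - 1} f_i(x)`. -/
def phi {n : ℕ} (N : NIndex (n + 1)) (x : Mon n) : Option (Mon (n + 1)) :=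
  if N.r = 0 then some (fMon N.i x)
  else if h : ∃ u, Compatible N x u then
    some (Finsupp.single N.i (2 ^ N.r - 1) + fMon N.i x - xIu N h.choose)
  else none

/-- `Φ^+(B)`: the monomials `φ_{(i;I)}(x)` with `x ∈ B` and `ℓ(I) > 0` that are not
in `P_k^0`, that is, in which every variable occurs. -/
def PhiPlus {n : ℕ} (B : Set (Mon n)) : Set (Mon (n + 1)) :=
  {y | (∃ N : NIndex (n + 1), 0 < N.r ∧ ∃ x ∈ B, phi N x = some y) ∧ ∀ j, 0 < y j}

/-! ## The 355 monomials -/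

/-- The monomial `x_1^a x_2^b x_3^c x_4^d x_5^e`. -/
def mon5 (a b c d e : ℕ) : Mon 5 := Finsupp.equivFunOnFinite.symm ![a, b, c, d, e]

/-- The 19 extra monomials. -/
def extraC : Set (Mon 5) :=
  {mon5 7 9 2 3 7, mon5 7 9 2 7 3, mon5 7 9 3 2 7,
   mon5 7 9 3 7 2, mon5 7 9 7 2 3, mon5 7 9 7 3 2,
   mon5 3 7 11 4 3, mon5 7 3 11 4 3, mon5 7 11 3 4 3,
   mon5 7 9 3 3 6, mon5 7 9 3 6 3, mon5 3 7 7 8 3,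
   mon5 3 7 8 3 7, mon5 3 7 8 7 3, mon5 7 3 7 8 3,
   mon5 7 3 8 3 7, mon5 7 3 8 7 3, mon5 7 7 3 8 3,
   mon5 7 7 8 3 3}

/-- `Φ^+(B_4(ω̄_{(5,3)})) ∪ C`. -/
def basisMonomials : Set (Mon 5) := PhiPlus (B 4 (omegaBar 5 3)) ∪ extraC

end

end HitProblem

/-! ### Steenrod squares on polynomials: Cartan formula, squares, naturality, degrees. -/

namespace HitProblem

/-! Split exponents into binary levels. A monomial of weight $(4,4,2,1)$ in five variables is given
by the variable $o_0$ missing from the lowest level, the variable $o_1$ missing from the next one,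
the pair $\{a,b\}$ of the third level and the single variable $d$ of the fourth; this is `term o₀ o₁
a b d`.

Spanning. A descent shows that $x^{2^a}y^{2^b}Sq^n f$ is hit unless $n+2^a+2^b$ is a sum of two
powers of two (`pow_mul_Sq_mem_hitDeg`). Since 7 and 15 are not such sums, multiplying the square of
a hit polynomial of degree 4 or 12 by four distinct variables gives a hit polynomial
(`varProd_mul_sq_mem`). Two consequences follow. All monomials of degree 28 and weight below
$(4,4,2,1)$ are hit (`toPoly_mem_hit_of_weight_lt`), and relations found in the upper levels lift to
degree 28. Modulo hit polynomials, terms with $a=b$ vanish, $o_0\neq o_1$ may be interchanged, and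
$Sq^1$ gives three further families of linear relations. Setting a variable to zero commutes with
the squares, so the projection onto $P_5^+$ preserves hit polynomials and may be applied to every
relation. A finite computation then expresses each positive monomial of this weight through $S$
(`spanning_check`).

Independence. The monomial $x_1^{15}x_2^7x_3^3x_4^3$ occurs in no $Sq^i f$ with $i>0$. Its
coefficient after a linear substitution $P_5\to P_4$ is therefore a functional that kills hit
polynomials, and on a term it is a product of determinants over $\mathbb F_2$ of sizes 4, 4, 2, 1
(`spikeFun_levels`). A list of 355 matrices gives functionals that separate the span of $S$
(`independence_check`).

The set $S$ itself has to be determined. In four variables both low levels are full, and the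
monomial with third level $a<b$ and fourth level $d$ is admissible exactly when $a\le d$ (`B_four`):
a $Sq^1$ relation removes the others, and sums of functionals as above detect the remaining 20. The
maps $\varphi_{(i;I)}$ are then enumerated (`phiPlus_eq`). Because lower weights are hit, the map
$P_5(\bar\omega)\to QP_5$ factors through $QP_5(\bar\omega)$, which transfers independence to the
second statement. -/

theorem Sq_apply {k : ℕ} (i : ℕ) (f : P k) : Sq k i f = (totalSq k f).coeff i := rfl

theorem totalSq_X {k : ℕ} (j : Fin k) :
    totalSq k (MvPolynomial.X j) = Polynomial.C (MvPolynomial.X j)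
      + Polynomial.C (MvPolynomial.X j ^ 2) * Polynomial.X := by
  simp [totalSq]

/-- The Cartan formula. -/
theorem Sq_mul {k : ℕ} (n : ℕ) (f g : P k) :
    Sq k n (f * g) = ∑ p ∈ Finset.HasAntidiagonal.antidiagonal n, Sq k p.1 f * Sq k p.2 g := by
  simp [Sq_apply, Polynomial.coeff_mul]

/-- In characteristic two, squaring a polynomial in $T$ applies Frobenius to its coefficients and
replaces $T$ by $T^2$. Hence even squares of $f^2$ are squares and odd ones vanish. -/
theorem totalSq_sq {k : ℕ} (f : P k) :
    totalSq k (f ^ 2) = Polynomial.expand (P k) 2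
      (Polynomial.map (frobenius (P k) 2) (totalSq k f)) := by
  rw [map_pow, ← Polynomial.map_expand, Polynomial.map_frobenius_expand]

theorem Sq_two_mul_sq {k : ℕ} (i : ℕ) (f : P k) : Sq k (2 * i) (f ^ 2) = Sq k i f ^ 2 := by
  rw [Sq_apply, totalSq_sq, mul_comm, Polynomial.coeff_expand_mul (by norm_num)]
  simp [Sq_apply, frobenius_def]

theorem Sq_odd_sq {k : ℕ} {i : ℕ} (hi : ¬ 2 ∣ i) (f : P k) : Sq k i (f ^ 2) = 0 := by
  rw [Sq_apply, totalSq_sq, Polynomial.coeff_expand (by norm_num), if_neg hi]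

theorem Sq_zero {k : ℕ} (f : P k) : Sq k 0 f = f := by
  have h : (Polynomial.constantCoeff.comp (totalSq k : P k →+* Polynomial (P k)))
      = RingHom.id (P k) := by
    apply MvPolynomial.ringHom_ext
    · intro r
      simp [totalSq, Polynomial.algebraMap_apply]
    · intro j
      simp [totalSq_X]
  have := RingHom.congr_fun h f
  simpa [Sq_apply, Polynomial.constantCoeff_apply] using this

theorem Sq_one_mul {k : ℕ} (f g : P k) : Sq k 1 (f * g) = Sq k 1 f * g + f * Sq k 1 g := by
  rw [Sq_mul]
  simp [Finset.Nat.antidiagonal_succ, Sq_zero, add_comm]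

theorem Sq_one_X {k : ℕ} (j : Fin k) :
    Sq k 1 (MvPolynomial.X j) = MvPolynomial.X j ^ 2 := by
  simp [Sq_apply, totalSq_X, -map_pow]

theorem Sq_one_sq {k : ℕ} (f : P k) : Sq k 1 (f ^ 2) = 0 := Sq_odd_sq (by norm_num) f

/-- `Sq 1` of a product of variables times a square. -/
theorem Sq_one_mul_sq {k : ℕ} (f g : P k) : Sq k 1 (f * g ^ 2) = Sq k 1 f * g ^ 2 := by
  rw [Sq_one_mul, Sq_one_sq, mul_zero, add_zero]

/-! ### Naturality -/

/-- The elements on which the total square is `L + L² T`. -/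
def IsLinearForm {k : ℕ} (L : P k) : Prop :=
  totalSq k L = Polynomial.C L + Polynomial.C (L ^ 2) * Polynomial.X

theorem isLinearForm_X {k : ℕ} (j : Fin k) : IsLinearForm (MvPolynomial.X j : P k) :=
  totalSq_X j

theorem isLinearForm_zero {k : ℕ} : IsLinearForm (0 : P k) := by
  simp [IsLinearForm]

theorem IsLinearForm.add {k : ℕ} {L M : P k} (hL : IsLinearForm L) (hM : IsLinearForm M) :
    IsLinearForm (L + M) := by
  unfold IsLinearForm at *
  rw [map_add, hL, hM, CharTwo.add_sq]
  simp only [map_add]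
  ring

/-- Both composites are algebra homomorphisms, so they need only agree on variables. This serves
both for setting a variable to zero and for the linear substitutions that define the functionals. -/
theorem Sq_aeval {k l : ℕ} {L : Fin k → P l} (hL : ∀ j, IsLinearForm (L j)) (i : ℕ) (f : P k) :
    Sq l i (MvPolynomial.aeval L f) = MvPolynomial.aeval L (Sq k i f) := by
  have h : (totalSq l).comp (MvPolynomial.aeval L)
      = (Polynomial.mapAlgHom (MvPolynomial.aeval L)).comp (totalSq k) := by
    apply MvPolynomial.algHom_ext
    intro j
    have := hL j
    unfold IsLinearForm at this
    simp [totalSq_X, this]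
  have h2 := AlgHom.congr_fun h f
  simp only [AlgHom.comp_apply] at h2
  rw [Sq_apply, h2]
  simp [Sq_apply]

/-! ### Hit polynomials -/

theorem Sq_mem_hit {k i : ℕ} (hi : 0 < i) (f : P k) : Sq k i f ∈ hit k :=
  Submodule.subset_span ⟨Sq k i, NonUnitalAlgebra.subset_adjoin _ ⟨i, hi, rfl⟩, f, rfl⟩

/-- The values of a composite of operators are among the values of its outermost factor, so single
squares already span the hit polynomials. -/
theorem hit_le {k : ℕ} {N : Submodule (ZMod 2) (P k)}
    (h : ∀ i, 0 < i → ∀ f : P k, Sq k i f ∈ N) : hit k ≤ N := by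
  refine Submodule.span_le.mpr ?_
  rintro _ ⟨θ, hθ, f, rfl⟩
  revert f
  refine NonUnitalAlgebra.adjoin_induction (p := fun θ _ => ∀ f, θ f ∈ N) ?_ ?_ ?_ ?_ ?_ hθ
  · rintro _ ⟨i, hi, rfl⟩ f
    exact h i hi f
  · intro a b _ _ ha hb f
    exact N.add_mem (ha f) (hb f)
  · intro f
    exact N.zero_mem
  · intro a b _ _ ha _ f
    exact ha (b f)
  · intro r a _ ha f
    exact N.smul_mem r (ha f)

theorem aeval_mem_hit {k l : ℕ} {L : Fin k → P l} (hL : ∀ j, IsLinearForm (L j)) {f : P k}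
    (hf : f ∈ hit k) : MvPolynomial.aeval L f ∈ hit l := by
  have : hit k ≤ (hit l).comap (MvPolynomial.aeval L).toLinearMap := by
    refine hit_le fun i hi g => ?_
    simp only [Submodule.mem_comap, AlgHom.toLinearMap_apply]
    rw [← Sq_aeval hL]
    exact Sq_mem_hit hi _
  exact this hf

/-! ### Degrees -/

theorem totalSq_monomial {k : ℕ} (a : Mon k) :
    totalSq k (toPoly a) = ∏ j, (Polynomial.C (MvPolynomial.X j)
      + Polynomial.C (MvPolynomial.X j ^ 2) * Polynomial.X) ^ a j := by
  rw [toPoly, totalSq, MvPolynomial.aeval_monomial, map_one, one_mul, Finsupp.prod_fintype]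
  simp

theorem toPoly_eq_prod {k : ℕ} (a : Mon k) : toPoly a = ∏ j, MvPolynomial.X j ^ a j := by
  rw [toPoly, MvPolynomial.monomial_eq, map_one, one_mul, Finsupp.prod_fintype]
  simp

theorem toPoly_mem_span {k : ℕ} (f : P k) : f = ∑ a ∈ f.support, toPoly a := by
  conv_lhs => rw [f.as_sum]
  refine Finset.sum_congr rfl fun a ha => ?_
  have : f.coeff a = 1 := by
    have h0 : f.coeff a ≠ 0 := MvPolynomial.mem_support_iff.mp ha
    revert h0
    generalize f.coeff a = c
    revert c
    decide
  rw [this, toPoly]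

theorem isHomogeneous_toPoly {k : ℕ} (a : Mon k) : (toPoly a).IsHomogeneous a.degree :=
  MvPolynomial.isHomogeneous_monomial _ rfl

/-- Induction on homogeneous polynomials over `F_2`. -/
theorem homogeneous_induction {k n : ℕ} {p : P k → Prop} (h0 : p 0)
    (hadd : ∀ f g, p f → p g → p (f + g)) (hmon : ∀ a : Mon k, a.degree = n → p (toPoly a))
    {f : P k} (hf : f.IsHomogeneous n) : p f := by
  rw [toPoly_mem_span f]
  refine Finset.sum_induction _ p hadd h0 fun a ha => hmon a ?_
  have := hf (MvPolynomial.mem_support_iff.mp ha)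
  rw [Finsupp.degree_eq_weight_one (R := ℕ)]
  exact this

/-- The total square of a monomial, expanded. -/
theorem totalSq_toPoly {k : ℕ} (a : Mon k) :
    totalSq k (toPoly a) = ∑ p ∈ Fintype.piFinset fun j => Finset.range (a j + 1),
      Polynomial.monomial (∑ j, p j)
        (MvPolynomial.monomial (a + Finsupp.equivFunOnFinite.symm p)
          (∏ j, ((a j).choose (p j) : ZMod 2))) := by
  rw [totalSq_monomial]
  have h : ∀ j, (Polynomial.C (MvPolynomial.X j : P k)
      + Polynomial.C (MvPolynomial.X j ^ 2) * Polynomial.X) ^ a j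
      = ∑ i ∈ Finset.range (a j + 1), Polynomial.monomial i
        (MvPolynomial.C ((a j).choose i : ZMod 2) * MvPolynomial.X j ^ (a j + i)) := by
    intro j
    rw [add_comm, add_pow]
    refine Finset.sum_congr rfl fun i hi => ?_
    have hi' : i ≤ a j := by simpa [Nat.lt_succ_iff] using hi
    obtain ⟨d, hd⟩ := Nat.exists_eq_add_of_le hi'
    rw [← Polynomial.C_mul_X_pow_eq_monomial, hd, Nat.add_sub_cancel_left, mul_pow]
    simp only [map_mul, map_pow, map_natCast]
    ring
  simp only [h]
  rw [Finset.prod_univ_sum]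
  refine Finset.sum_congr rfl fun p _ => ?_
  have h2 : (MvPolynomial.monomial (a + Finsupp.equivFunOnFinite.symm p)
          (∏ j, ((a j).choose (p j) : ZMod 2)) : P k)
      = ∏ j, MvPolynomial.C ((a j).choose (p j) : ZMod 2) * MvPolynomial.X j ^ (a j + p j) := by
    rw [Finset.prod_mul_distrib, MvPolynomial.monomial_eq, Finsupp.prod_fintype _ _ (by simp),
      map_prod]
    simp
  rw [h2]
  have : ∀ (q : Fin k → P k) (s : Finset (Fin k)), ∏ j ∈ s, Polynomial.monomial (p j) (q j)
      = Polynomial.monomial (∑ j ∈ s, p j) (∏ j ∈ s, q j) := by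
    intro q s
    induction s using Finset.induction_on with
    | empty => simp
    | insert i s hi ih => simp [hi, ih, Polynomial.monomial_mul_monomial]
  exact this _ _

theorem Sq_toPoly {k : ℕ} (n : ℕ) (a : Mon k) :
    Sq k n (toPoly a) = ∑ p ∈ Fintype.piFinset fun j => Finset.range (a j + 1),
      if ∑ j, p j = n then (MvPolynomial.monomial (a + Finsupp.equivFunOnFinite.symm p)
          (∏ j, ((a j).choose (p j) : ZMod 2)) : P k) else 0 := by
  rw [Sq_apply, totalSq_toPoly, Polynomial.finsetSum_coeff]
  simp [Polynomial.coeff_monomial]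

theorem isHomogeneous_Sq {k n : ℕ} (i : ℕ) {f : P k} (hf : f.IsHomogeneous n) :
    (Sq k i f).IsHomogeneous (n + i) := by
  refine homogeneous_induction (p := fun f => (Sq k i f).IsHomogeneous (n + i)) ?_ ?_ ?_ hf
  · simpa using MvPolynomial.isHomogeneous_zero _ _ _
  · intro f g hf hg
    rw [map_add]
    exact hf.add hg
  · intro a ha
    rw [Sq_toPoly]
    refine MvPolynomial.IsHomogeneous.sum _ _ _ fun p _ => ?_
    split_ifs with h
    · refine MvPolynomial.isHomogeneous_monomial _ ?_
      rw [map_add, ha, ← h, Finsupp.degree_eq_sum]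
      simp
    · exact MvPolynomial.isHomogeneous_zero _ _ _

theorem Sq_degree {k n : ℕ} {f : P k} (hf : f.IsHomogeneous n) : Sq k n f = f ^ 2 := by
  refine homogeneous_induction (p := fun f => Sq k n f = f ^ 2) ?_ ?_ ?_ hf
  · simp
  · intro f g hf hg
    rw [map_add, hf, hg, CharTwo.add_sq]
  · intro a ha
    rw [Sq_toPoly, Finset.sum_eq_single (⇑a)]
    · rw [if_pos (by rw [← ha, Finsupp.degree_eq_sum])]
      simp [toPoly, MvPolynomial.monomial_pow, two_smul]
    · intro p hp hpa
      rw [if_neg]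
      intro h
      apply hpa
      simp only [Fintype.mem_piFinset, Finset.mem_range, Nat.lt_succ_iff] at hp
      rw [← ha, Finsupp.degree_eq_sum] at h
      funext j
      exact (Finset.sum_eq_sum_iff_of_le (fun j _ => hp j)).mp h j (Finset.mem_univ j)
    · intro h
      simp at h

end HitProblem

/-! ### Criteria for hit polynomials; monomials of smaller weight in degree 28. -/

namespace HitProblem

open MvPolynomial (X)

/-- The homogeneous hit polynomials of degree `d`. -/
noncomputable def hitDeg (k d : ℕ) : Submodule (ZMod 2) (P k) :=
  Submodule.span (ZMod 2)
    {g | ∃ (i n : ℕ) (f : P k), 0 < i ∧ f.IsHomogeneous n ∧ n + i = d ∧ g = Sq k i f}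

theorem hitDeg_le_hit (k d : ℕ) : hitDeg k d ≤ hit k := by
  refine Submodule.span_le.mpr ?_
  rintro _ ⟨i, n, f, hi, -, -, rfl⟩
  exact Sq_mem_hit hi f

theorem Sq_mem_hitDeg {k i n d : ℕ} {f : P k} (hi : 0 < i) (hf : f.IsHomogeneous n)
    (hd : n + i = d) : Sq k i f ∈ hitDeg k d :=
  Submodule.subset_span ⟨i, n, f, hi, hf, hd, rfl⟩

theorem sq_mem_hitDeg {k n d : ℕ} {f : P k} (hn : 0 < n) (hf : f.IsHomogeneous n)
    (hd : d = 2 * n) : f ^ 2 ∈ hitDeg k d := by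
  rw [← Sq_degree hf]
  exact Sq_mem_hitDeg hn hf (by omega)

theorem totalSq_X_pow {k : ℕ} (j : Fin k) (a : ℕ) :
    totalSq k (X j ^ 2 ^ a) = Polynomial.C (X j ^ 2 ^ a)
      + Polynomial.C (X j ^ 2 ^ (a + 1)) * Polynomial.X ^ 2 ^ a := by
  rw [map_pow, totalSq_X, add_pow_char_pow, mul_pow, pow_succ 2 a, pow_mul']
  simp only [map_pow]

/-- `N` is not a sum of two powers of two. -/
def NotSumTwoPow (N : ℕ) : Prop := ∀ c e : ℕ, N ≠ 2 ^ c + 2 ^ e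

theorem notSumTwoPow_of_le {N : ℕ} (hN : N < 16)
    (h : ∀ c < 4, ∀ e < 4, N ≠ 2 ^ c + 2 ^ e) : NotSumTwoPow N := by
  have aux : ∀ c, 4 ≤ c → 16 ≤ 2 ^ c := fun c hc =>
    (by norm_num : 16 = 2 ^ 4) ▸ Nat.pow_le_pow_right (by norm_num) hc
  intro c e he
  have p1 : 0 < 2 ^ c := by positivity
  have p2 : 0 < 2 ^ e := by positivity
  by_cases hc : c < 4
  · by_cases hee : e < 4
    · exact h c hc e hee he
    · have := aux e (by omega)
      omega
  · have := aux c (by omega)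
    omega

/-- Expand $Sq^n(x^{2^a}y^{2^b}f)$. The only nontrivial square on $x^{2^a}$ doubles the exponent, so
the error terms have the same form with a smaller $n$ and the same sum $n+2^a+2^b$. The descent
cannot reach $n=0$, where this sum would be $2^a+2^b$. -/
theorem pow_mul_Sq_mem_hitDeg {k : ℕ} (x y : Fin k) {m : ℕ} {f : P k} (hf : f.IsHomogeneous m) :
    ∀ (n a b d : ℕ), NotSumTwoPow (n + 2 ^ a + 2 ^ b) → 2 ^ a + 2 ^ b + n + m = d →
      X x ^ 2 ^ a * X y ^ 2 ^ b * Sq k n f ∈ hitDeg k d := by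
  intro n
  induction n using Nat.strong_induction_on with
  | _ n ih =>
    intro a b d hN hd
    have hpa : 0 < 2 ^ a := by positivity
    have hpb : 0 < 2 ^ b := by positivity
    have hn : 0 < n := by
      rcases Nat.eq_zero_or_pos n with h | h
      · subst h
        exact absurd (by ring) (hN a b)
      · exact h
    have key : Sq k n (X x ^ 2 ^ a * X y ^ 2 ^ b * f) =
        X x ^ 2 ^ a * X y ^ 2 ^ b * Sq k n f
        + (if 2 ^ a ≤ n then X x ^ 2 ^ (a + 1) * X y ^ 2 ^ b * Sq k (n - 2 ^ a) f else 0)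
        + (if 2 ^ b ≤ n then X x ^ 2 ^ a * X y ^ 2 ^ (b + 1) * Sq k (n - 2 ^ b) f else 0)
        + (if 2 ^ a + 2 ^ b ≤ n then
            X x ^ 2 ^ (a + 1) * X y ^ 2 ^ (b + 1) * Sq k (n - (2 ^ a + 2 ^ b)) f else 0) := by
      have e : totalSq k (X x ^ 2 ^ a * X y ^ 2 ^ b * f)
          = Polynomial.C (X x ^ 2 ^ a * X y ^ 2 ^ b) * totalSq k f
          + Polynomial.C (X x ^ 2 ^ (a + 1) * X y ^ 2 ^ b) * (totalSq k f * Polynomial.X ^ 2 ^ a)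
          + Polynomial.C (X x ^ 2 ^ a * X y ^ 2 ^ (b + 1)) * (totalSq k f * Polynomial.X ^ 2 ^ b)
          + Polynomial.C (X x ^ 2 ^ (a + 1) * X y ^ 2 ^ (b + 1))
            * (totalSq k f * Polynomial.X ^ (2 ^ a + 2 ^ b)) := by
        rw [map_mul, map_mul, totalSq_X_pow, totalSq_X_pow, pow_add Polynomial.X]
        simp only [map_mul]
        ring
      rw [Sq_apply, e]
      simp only [Polynomial.coeff_add, Polynomial.coeff_C_mul, Polynomial.coeff_mul_X_pow',
        mul_ite, mul_zero, Sq_apply]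
    have hom : (X x ^ 2 ^ a * X y ^ 2 ^ b * f : P k).IsHomogeneous (2 ^ a + 2 ^ b + m) := by
      refine MvPolynomial.IsHomogeneous.mul (MvPolynomial.IsHomogeneous.mul ?_ ?_) hf
      · simpa using (MvPolynomial.isHomogeneous_X (ZMod 2) x).pow (2 ^ a)
      · simpa using (MvPolynomial.isHomogeneous_X (ZMod 2) y).pow (2 ^ b)
    have h0 := Sq_mem_hitDeg (d := d) hn hom (by omega)
    rw [key] at h0
    have h1 : (if 2 ^ a ≤ n then X x ^ 2 ^ (a + 1) * X y ^ 2 ^ b * Sq k (n - 2 ^ a) f else 0)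
        ∈ hitDeg k d := by
      split_ifs with h
      · refine ih _ (by omega) _ _ _ ?_ ?_
        · rwa [show n - 2 ^ a + 2 ^ (a + 1) + 2 ^ b = n + 2 ^ a + 2 ^ b by rw [pow_succ]; omega]
        · rw [pow_succ]; omega
      · exact zero_mem _
    have h2 : (if 2 ^ b ≤ n then X x ^ 2 ^ a * X y ^ 2 ^ (b + 1) * Sq k (n - 2 ^ b) f else 0)
        ∈ hitDeg k d := by
      split_ifs with h
      · refine ih _ (by omega) _ _ _ ?_ ?_
        · rwa [show n - 2 ^ b + 2 ^ a + 2 ^ (b + 1) = n + 2 ^ a + 2 ^ b by rw [pow_succ]; omega]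
        · rw [pow_succ]; omega
      · exact zero_mem _
    have h3 : (if 2 ^ a + 2 ^ b ≤ n then
            X x ^ 2 ^ (a + 1) * X y ^ 2 ^ (b + 1) * Sq k (n - (2 ^ a + 2 ^ b)) f else 0)
        ∈ hitDeg k d := by
      split_ifs with h
      · refine ih _ (by omega) _ _ _ ?_ ?_
        · rwa [show n - (2 ^ a + 2 ^ b) + 2 ^ (a + 1) + 2 ^ (b + 1) = n + 2 ^ a + 2 ^ b by
            rw [pow_succ, pow_succ]; omega]
        · rw [pow_succ, pow_succ]; omega
      · exact zero_mem _
    exact (Submodule.add_mem_iff_left _ h1).mp ((Submodule.add_mem_iff_left _ h2).mp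
      ((Submodule.add_mem_iff_left _ h3).mp h0))

/-- The case $a=b=0$ of the descent, with $n=\deg g$, where $Sq^n g=g^2$. -/
theorem two_mul_sq_mem_hitDeg {k n d : ℕ} (x y : Fin k) {g : P k} (hg : g.IsHomogeneous n)
    (hN : NotSumTwoPow (n + 2)) (hd : d = 2 * n + 2) : X x * X y * g ^ 2 ∈ hitDeg k d := by
  have := pow_mul_Sq_mem_hitDeg x y hg n 0 0 d (by simpa [add_assoc] using hN) (by omega)
  simpa [Sq_degree hg] using this

/-- The product of the variables indexed by `J`. -/
noncomputable def varProd {k : ℕ} (J : Finset (Fin k)) : P k := ∏ j ∈ J, X j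

theorem isHomogeneous_varProd {k : ℕ} (J : Finset (Fin k)) :
    (varProd J).IsHomogeneous J.card := by
  have := MvPolynomial.IsHomogeneous.prod J (fun j => (X j : P k)) (fun _ => 1)
    fun j _ => MvPolynomial.isHomogeneous_X _ j
  simpa [varProd] using this

/-- Apply $Sq^{2i}$ to the four variables times $f^2$. Odd squares of $f^2$ vanish, so either none,
two or all four of the variables get squared. None gives the wanted term. Two leave $xy\,g^2$ with
$\deg g=d+1$, which is hit because $d+3$ is not a sum of two powers of two. Four give a square of
positive degree, which is hit. -/
theorem varProd_mul_Sq_sq_mem {k d i n : ℕ} {J : Finset (Fin k)} (hJ : J.card = 4)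
    (hN : NotSumTwoPow (d + 3)) (hi : 0 < i) {f : P k} (hf : f.IsHomogeneous n) (hd : n + i = d) :
    varProd J * Sq k i f ^ 2 ∈ hitDeg k (2 * d + 4) := by
  have hom := (isHomogeneous_varProd J).mul (hf.pow 2)
  obtain ⟨a, t, hat, rfl, ht⟩ := Finset.card_eq_succ.mp hJ
  obtain ⟨b, c, e, hbc, hbe, hce, rfl⟩ := Finset.card_eq_three.mp ht
  have hv : varProd (insert a {b, c, e}) = X a * X b * X c * X e := by
    rw [varProd, Finset.prod_insert hat, Finset.prod_insert (by simp [hbc, hbe]),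
      Finset.prod_insert (by simp [hce]), Finset.prod_singleton]
    ring
  rw [hv, hJ] at hom
  rw [hv]
  have key : Sq k (2 * i) (X a * X b * X c * X e * f ^ 2) =
      X a * X b * X c * X e * Sq k i f ^ 2
      + (X a * X b * (X c * X e * Sq k (i - 1) f) ^ 2
        + X a * X c * (X b * X e * Sq k (i - 1) f) ^ 2
        + X a * X e * (X b * X c * Sq k (i - 1) f) ^ 2
        + X b * X c * (X a * X e * Sq k (i - 1) f) ^ 2
        + X b * X e * (X a * X c * Sq k (i - 1) f) ^ 2
        + X c * X e * (X a * X b * Sq k (i - 1) f) ^ 2)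
      + (if 2 ≤ i then (X a * X b * X c * X e * Sq k (i - 2) f) ^ 2 else 0) := by
    have e1 : totalSq k (X a * X b * X c * X e * f ^ 2)
        = Polynomial.C (X a * X b * X c * X e) * totalSq k (f ^ 2)
        + Polynomial.C (X a ^ 2 * X b * X c * X e + X a * X b ^ 2 * X c * X e
          + X a * X b * X c ^ 2 * X e + X a * X b * X c * X e ^ 2)
            * (totalSq k (f ^ 2) * Polynomial.X ^ 1)
        + Polynomial.C (X a * X b * (X c * X e) ^ 2 + X a * X c * (X b * X e) ^ 2
          + X a * X e * (X b * X c) ^ 2 + X b * X c * (X a * X e) ^ 2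
          + X b * X e * (X a * X c) ^ 2 + X c * X e * (X a * X b) ^ 2)
            * (totalSq k (f ^ 2) * Polynomial.X ^ 2)
        + Polynomial.C (X a * X b ^ 2 * X c ^ 2 * X e ^ 2 + X a ^ 2 * X b * X c ^ 2 * X e ^ 2
          + X a ^ 2 * X b ^ 2 * X c * X e ^ 2 + X a ^ 2 * X b ^ 2 * X c ^ 2 * X e)
            * (totalSq k (f ^ 2) * Polynomial.X ^ 3)
        + Polynomial.C ((X a * X b * X c * X e) ^ 2)
            * (totalSq k (f ^ 2) * Polynomial.X ^ 4) := by
      simp only [map_mul, totalSq_X, map_add, map_pow]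
      ring
    rw [Sq_apply, e1]
    simp only [Polynomial.coeff_add, Polynomial.coeff_C_mul, Polynomial.coeff_mul_X_pow',
      ← Sq_apply]
    have o1 : Sq k (2 * i - 1) (f ^ 2) = 0 := Sq_odd_sq (by omega) f
    have o3 : 3 ≤ 2 * i → Sq k (2 * i - 3) (f ^ 2) = 0 := fun h => Sq_odd_sq (by omega) f
    rw [Sq_two_mul_sq, o1, if_pos (show 2 ≤ 2 * i by omega),
      show 2 * i - 2 = 2 * (i - 1) by omega, Sq_two_mul_sq]
    by_cases h2 : 2 ≤ i
    · rw [if_pos (show 3 ≤ 2 * i by omega), o3 (by omega), if_pos (show 4 ≤ 2 * i by omega),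
        if_pos h2, show 2 * i - 4 = 2 * (i - 2) by omega, Sq_two_mul_sq]
      simp only [ite_self]
      ring
    · rw [if_neg (show ¬ 3 ≤ 2 * i by omega), if_neg (show ¬ 4 ≤ 2 * i by omega), if_neg h2]
      simp only [ite_self]
      ring
  have h0 := Sq_mem_hitDeg (d := 2 * d + 4) (show 0 < 2 * i by omega) hom (by omega)
  rw [key] at h0
  have pair : ∀ x y z w : Fin k,
      X x * X y * (X z * X w * Sq k (i - 1) f) ^ 2 ∈ hitDeg k (2 * d + 4) := by
    intro x y z w
    have hg : (X z * X w * Sq k (i - 1) f : P k).IsHomogeneous (d + 1) := by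
      have := ((MvPolynomial.isHomogeneous_X (ZMod 2) z).mul
        (MvPolynomial.isHomogeneous_X (ZMod 2) w)).mul (isHomogeneous_Sq (i - 1) hf)
      rwa [show 1 + 1 + (n + (i - 1)) = d + 1 by omega] at this
    exact two_mul_sq_mem_hitDeg x y hg hN (by ring)
  have h2 : (if 2 ≤ i then (X a * X b * X c * X e * Sq k (i - 2) f) ^ 2 else 0)
      ∈ hitDeg k (2 * d + 4) := by
    split_ifs with h
    · have hg : (X a * X b * X c * X e * Sq k (i - 2) f : P k).IsHomogeneous (d + 2) := by
        have := ((((MvPolynomial.isHomogeneous_X (ZMod 2) a).mul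
          (MvPolynomial.isHomogeneous_X (ZMod 2) b)).mul
          (MvPolynomial.isHomogeneous_X (ZMod 2) c)).mul
          (MvPolynomial.isHomogeneous_X (ZMod 2) e)).mul (isHomogeneous_Sq (i - 2) hf)
        rwa [show 1 + 1 + 1 + 1 + (n + (i - 2)) = d + 2 by omega] at this
      exact sq_mem_hitDeg (by omega) hg (by ring)
    · exact zero_mem _
  refine (Submodule.add_mem_iff_left _ ?_).mp ((Submodule.add_mem_iff_left _ h2).mp h0)
  exact add_mem (add_mem (add_mem (add_mem (add_mem (pair _ _ _ _) (pair _ _ _ _))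
    (pair _ _ _ _)) (pair _ _ _ _)) (pair _ _ _ _)) (pair _ _ _ _)

theorem varProd_mul_sq_mem {k d d' : ℕ} {J : Finset (Fin k)} (hJ : J.card = 4)
    (hN : NotSumTwoPow (d + 3)) {h : P k} (hh : h ∈ hitDeg k d) (hd : d' = 2 * d + 4) :
    varProd J * h ^ 2 ∈ hitDeg k d' := by
  subst hd
  induction hh using Submodule.span_induction with
  | mem x hx =>
    obtain ⟨i, n, f, hi, hf, hd, rfl⟩ := hx
    exact varProd_mul_Sq_sq_mem hJ hN hi hf hd
  | zero => simp
  | add x y _ _ hx hy =>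
    rw [CharTwo.add_sq, mul_add]
    exact add_mem hx hy
  | smul r x _ hx =>
    rw [smul_pow, mul_smul_comm]
    exact Submodule.smul_mem _ _ hx

theorem notSumTwoPow_fifteen : NotSumTwoPow 15 := notSumTwoPow_of_le (by norm_num) (by decide)

theorem notSumTwoPow_seven : NotSumTwoPow 7 := notSumTwoPow_of_le (by norm_num) (by decide)

/-! ### Monomials by binary levels -/

/-- The variables with odd exponent. -/
def oddVars {k : ℕ} (a : Mon k) : Finset (Fin k) := Finset.univ.filter fun j => a j % 2 = 1

/-- The monomial with all exponents halved. -/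
noncomputable def half {k : ℕ} (a : Mon k) : Mon k := a.mapRange (· / 2) (by simp)

theorem toPoly_eq_varProd_mul {k : ℕ} (a : Mon k) :
    toPoly a = varProd (oddVars a) * toPoly (half a) ^ 2 := by
  rw [toPoly_eq_prod, toPoly_eq_prod, varProd, oddVars, Finset.prod_filter, ← Finset.prod_pow,
    ← Finset.prod_mul_distrib]
  refine Finset.prod_congr rfl fun j _ => ?_
  conv_lhs => rw [← Nat.mod_add_div (a j) 2]
  rw [pow_add, half, Finsupp.mapRange_apply, ← pow_mul, mul_comm (a j / 2) 2]
  congr 1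
  rcases Nat.mod_two_eq_zero_or_one (a j) with h | h <;> simp [h]

theorem degree_eq_card_add {k : ℕ} (a : Mon k) :
    a.degree = (oddVars a).card + 2 * (half a).degree := by
  rw [Finsupp.degree_eq_sum, Finsupp.degree_eq_sum, oddVars, Finset.card_filter, Finset.mul_sum,
    ← Finset.sum_add_distrib]
  refine Finset.sum_congr rfl fun j _ => ?_
  rw [half, Finsupp.mapRange_apply]
  split_ifs <;> omega

theorem weight_apply {k : ℕ} (a : Mon k) (i : ℕ) : weight a i = ∑ j, alpha i (a j) := rfl

theorem weight_zero_eq {k : ℕ} (a : Mon k) : weight a 0 = (oddVars a).card := by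
  rw [weight_apply, oddVars, Finset.card_filter]
  refine Finset.sum_congr rfl fun j _ => ?_
  simp only [alpha, pow_zero, Nat.div_one]
  split_ifs <;> omega

theorem weight_half {k : ℕ} (a : Mon k) (i : ℕ) : weight (half a) i = weight a (i + 1) := by
  rw [weight_apply, weight_apply]
  refine Finset.sum_congr rfl fun j _ => ?_
  rw [half, Finsupp.mapRange_apply, alpha, alpha, Nat.div_div_eq_div_mul, pow_succ']

theorem toPoly_mem_hitDeg_of_card_two {k n : ℕ} {a : Mon k} (ha : (oddVars a).card = 2)
    (hn : (half a).degree = n) (hN : NotSumTwoPow (n + 2)) : toPoly a ∈ hitDeg k a.degree := by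
  obtain ⟨x, y, hxy, h⟩ := Finset.card_eq_two.mp ha
  rw [toPoly_eq_varProd_mul, h, varProd, Finset.prod_pair hxy]
  refine two_mul_sq_mem_hitDeg x y (n := n) ?_ hN ?_
  · rw [← hn]
    exact isHomogeneous_toPoly _
  · rw [degree_eq_card_add, ha, hn, add_comm]

theorem toPoly_mem_hitDeg_of_card_zero {k : ℕ} {a : Mon k} (ha : (oddVars a).card = 0)
    (h0 : 0 < a.degree) : toPoly a ∈ hitDeg k a.degree := by
  have hd := degree_eq_card_add a
  rw [toPoly_eq_varProd_mul, Finset.card_eq_zero.mp ha, varProd, Finset.prod_empty, one_mul]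
  exact sq_mem_hitDeg (by omega) (isHomogeneous_toPoly _) (by omega)

theorem toPoly_mem_hitDeg_four {k : ℕ} {a : Mon k} (hd : a.degree = 4) (h : weight a 0 < 2) :
    toPoly a ∈ hitDeg k 4 := by
  have h1 := degree_eq_card_add a
  have h2 := weight_zero_eq a
  rw [← hd]
  exact toPoly_mem_hitDeg_of_card_zero (by omega) (by omega)

/-- The number of odd exponents has the parity of the degree. Zero of them means a square; two leave
a squared factor of degree 5, and $5+2=7$; with four, the statement lifts from degree 4. Degree 28
below goes the same way, with 13 and 15 for 5 and 7. -/
theorem toPoly_mem_hitDeg_twelve {k : ℕ} {a : Mon k} (hd : a.degree = 12)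
    (h : weight a 0 < 4 ∨ (weight a 0 = 4 ∧ weight a 1 < 2)) :
    toPoly a ∈ hitDeg k 12 := by
  have h1 := degree_eq_card_add a
  have h2 := weight_zero_eq a
  rcases h with h | ⟨h, h'⟩
  · rw [← hd]
    have : (oddVars a).card = 0 ∨ (oddVars a).card = 2 := by omega
    rcases this with h3 | h3
    · exact toPoly_mem_hitDeg_of_card_zero h3 (by omega)
    · exact toPoly_mem_hitDeg_of_card_two h3 (n := 5) (by omega) notSumTwoPow_seven
  · rw [toPoly_eq_varProd_mul]
    refine varProd_mul_sq_mem (by omega) notSumTwoPow_seven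
      (toPoly_mem_hitDeg_four (by omega) ?_) (by norm_num)
    rwa [weight_half]

theorem toPoly_mem_hitDeg_twentyEight {k : ℕ} {a : Mon k} (hd : a.degree = 28)
    (h : weight a 0 < 4 ∨ (weight a 0 = 4 ∧
      (weight a 1 < 4 ∨ (weight a 1 = 4 ∧ weight a 2 < 2)))) :
    toPoly a ∈ hitDeg k 28 := by
  have h1 := degree_eq_card_add a
  have h2 := weight_zero_eq a
  rcases h with h | ⟨h, h'⟩
  · rw [← hd]
    have : (oddVars a).card = 0 ∨ (oddVars a).card = 2 := by omega
    rcases this with h3 | h3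
    · exact toPoly_mem_hitDeg_of_card_zero h3 (by omega)
    · exact toPoly_mem_hitDeg_of_card_two h3 (n := 13) (by omega) notSumTwoPow_fifteen
  · rw [toPoly_eq_varProd_mul]
    refine varProd_mul_sq_mem (by omega) notSumTwoPow_fifteen
      (toPoly_mem_hitDeg_twelve (by omega) ?_) (by norm_num)
    rwa [weight_half, weight_half]

theorem omegaBar_five_three : omegaBar 5 3 = Finsupp.single 0 4 + Finsupp.single 1 4
    + Finsupp.single 2 2 + Finsupp.single 3 1 := by
  simp [omegaBar, Finset.sum_range_succ]

theorem omegaBar_apply (i : ℕ) : omegaBar 5 3 i =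
    if i = 0 then 4 else if i = 1 then 4 else if i = 2 then 2 else if i = 3 then 1 else 0 := by
  rw [omegaBar_five_three]
  simp only [Finsupp.add_apply, Finsupp.single_apply]
  split_ifs <;> omega

theorem weightDegree_omegaBar : weightDegree (omegaBar 5 3) = 28 := by
  rw [weightDegree, omegaBar_five_three]
  repeat rw [Finsupp.sum_add_index' (by simp) (by intros; ring)]
  simp

/-- The monomials of weight less than that of the minimal spike are hit. -/
theorem toPoly_mem_hit_of_weight_lt {k : ℕ} {a : Mon k} (hd : a.degree = 28)
    (h : toLex (weight a) < toLex (omegaBar 5 3)) : toPoly a ∈ hit k := by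
  refine hitDeg_le_hit k 28 (toPoly_mem_hitDeg_twentyEight hd ?_)
  -- The comparison is decided in the first three entries: if these are 4, 4, 2, the degree left for
  -- the higher levels is $8\cdot 1$, which forces the rest of the weight vector.
  obtain ⟨j, hj, hlt⟩ := Finsupp.Lex.lt_iff.mp h
  simp only [ofLex_toLex] at hj hlt
  have e0 := hj 0
  have e1 := hj 1
  have e2 := hj 2
  have h1 := degree_eq_card_add a
  have h2 := weight_zero_eq a
  have h3 := degree_eq_card_add (half a)
  have h4 := weight_zero_eq (half a)
  have h5 := degree_eq_card_add (half (half a))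
  have h6 := weight_zero_eq (half (half a))
  have h7 := degree_eq_card_add (half (half (half a)))
  have h8 := weight_zero_eq (half (half (half a)))
  simp only [weight_half, zero_add, Nat.reduceAdd] at h4 h6 h8
  simp only [omegaBar_apply, Nat.reduceEqDiff, if_true, if_false, one_ne_zero] at e0 e1 e2 hlt
  split_ifs at hlt <;> subst_vars <;> simp at * <;> omega

end HitProblem

/-! ### Relations between the monomials of weight $(4,4,2,1)$, and the projection onto $P_k^+$. -/

namespace HitProblem

open MvPolynomial (X)

/-- The monomial of weight `(4, 4, 2, 1)` with binary levels `J₀`, `J₁`, `{a, b}` and `{d}`. -/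
noncomputable def levels {k : ℕ} (J₀ J₁ : Finset (Fin k)) (a b d : Fin k) : P k :=
  varProd J₀ * (varProd J₁ * (X a * X b * X d ^ 2) ^ 2) ^ 2

theorem levels_swap {k : ℕ} (J₀ J₁ : Finset (Fin k)) (a b d : Fin k) :
    levels J₀ J₁ a b d = levels J₀ J₁ b a d := by
  rw [levels, levels, mul_comm (X a)]

section Relations

variable {k : ℕ} {J₀ J₁ : Finset (Fin k)}

/-- The degrees run $4\to 12\to 28$ under $d\mapsto 2d+4$, and $d+3$ is 7 and then 15. -/
theorem lift_lift (h₀ : J₀.card = 4) (h₁ : J₁.card = 4) {h : P k} (hh : h ∈ hitDeg k 4) :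
    varProd J₀ * (varProd J₁ * h ^ 2) ^ 2 ∈ hit k :=
  hitDeg_le_hit k 28 (varProd_mul_sq_mem h₀ notSumTwoPow_fifteen
    (varProd_mul_sq_mem h₁ notSumTwoPow_seven hh (d' := 12) (by norm_num)) (by norm_num))

theorem levels_self_mem_hit (h₀ : J₀.card = 4) (h₁ : J₁.card = 4) (a d : Fin k) :
    levels J₀ J₁ a a d ∈ hit k := by
  refine lift_lift h₀ h₁ ?_
  rw [show (X a * X a * X d ^ 2 : P k) = (X a * X d) ^ 2 by ring]
  exact sq_mem_hitDeg (n := 2) (by norm_num)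
    ((MvPolynomial.isHomogeneous_X _ a).mul (MvPolynomial.isHomogeneous_X _ d)) (by norm_num)

/-- The relation coming from `Sq¹ (x_a x_b x_c)` in the two top levels. -/
theorem levels_triple_mem_hit (h₀ : J₀.card = 4) (h₁ : J₁.card = 4) (a b c : Fin k) :
    levels J₀ J₁ b c a + levels J₀ J₁ a c b + levels J₀ J₁ a b c ∈ hit k := by
  have hom : (X a * X b * X c : P k).IsHomogeneous 3 :=
    ((MvPolynomial.isHomogeneous_X _ a).mul (MvPolynomial.isHomogeneous_X _ b)).mul
      (MvPolynomial.isHomogeneous_X _ c)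
  have := lift_lift h₀ h₁ (Sq_mem_hitDeg (i := 1) (d := 4) (by norm_num) hom (by norm_num))
  rw [Sq_one_mul, Sq_one_mul, Sq_one_X, Sq_one_X, Sq_one_X] at this
  convert this using 1
  rw [levels, levels, levels, ← mul_add, ← CharTwo.add_sq, ← mul_add, ← CharTwo.add_sq, ← mul_add,
    ← CharTwo.add_sq, ← mul_add, ← CharTwo.add_sq]
  ring

end Relations

theorem Sq_one_varProd {k : ℕ} (J : Finset (Fin k)) :
    Sq k 1 (varProd J) = ∑ j ∈ J, varProd (J.erase j) * X j ^ 2 := by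
  induction J using Finset.induction_on with
  | empty =>
    have := Sq_one_sq (k := k) 1
    simpa [varProd] using this
  | insert i s hi ih =>
    rw [Finset.sum_insert hi, Finset.erase_insert hi, varProd, Finset.prod_insert hi, Sq_one_mul,
      Sq_one_X, ← varProd, ih, Finset.mul_sum, mul_comm (X i ^ 2)]
    congr 1
    refine Finset.sum_congr rfl fun j hj => ?_
    have hij : i ≠ j := fun h => hi (h ▸ hj)
    rw [Finset.erase_insert_of_ne hij, varProd, varProd,
      Finset.prod_insert (fun h => hi (Finset.mem_of_mem_erase h)), mul_assoc]

/-- All variables but one. -/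
def allBut (o : Fin 5) : Finset (Fin 5) := Finset.univ.erase o

theorem card_allBut (o : Fin 5) : (allBut o).card = 4 := by simp [allBut]

theorem varProd_erase_mul {k : ℕ} {J : Finset (Fin k)} {j : Fin k} (hj : j ∈ J) :
    X j * varProd (J.erase j) = varProd J := Finset.mul_prod_erase J _ hj

theorem X_mul_varProd {k : ℕ} {J : Finset (Fin k)} {j : Fin k} (hj : j ∈ J) :
    X j * varProd J = varProd (J.erase j) * X j ^ 2 := by
  rw [← varProd_erase_mul hj]
  ring

/-- A monomial of `P 5` of weight `(4, 4, 2, 1)`; the first two levels are given by the missing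
variable. -/
noncomputable def term (o₀ o₁ a b d : Fin 5) : P 5 := levels (allBut o₀) (allBut o₁) a b d

theorem term_swap (o₀ o₁ a b d : Fin 5) : term o₀ o₁ a b d = term o₀ o₁ b a d :=
  levels_swap _ _ _ _ _

theorem term_self_mem_hit (o₀ o₁ a d : Fin 5) : term o₀ o₁ a a d ∈ hit 5 :=
  levels_self_mem_hit (card_allBut _) (card_allBut _) a d

theorem term_triple_mem_hit (o₀ o₁ a b c : Fin 5) :
    term o₀ o₁ b c a + term o₀ o₁ a c b + term o₀ o₁ a b c ∈ hit 5 :=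
  levels_triple_mem_hit (card_allBut _) (card_allBut _) a b c

theorem isHomogeneous_top {k : ℕ} (a b d : Fin k) : (X a * X b * X d ^ 2 : P k).IsHomogeneous 4 :=
  ((MvPolynomial.isHomogeneous_X _ a).mul (MvPolynomial.isHomogeneous_X _ b)).mul
      ((MvPolynomial.isHomogeneous_X _ d).pow 2)

theorem Sq_one_univ_mul_sq (f : P 5) :
    Sq 5 1 (varProd Finset.univ * f ^ 2) = ∑ j, varProd (allBut j) * (X j * f) ^ 2 := by
  rw [Sq_one_mul_sq, Sq_one_varProd, Finset.sum_mul]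
  refine Finset.sum_congr rfl fun j _ => ?_
  rw [allBut]
  ring

/-- The relation coming from `Sq¹` in the two middle levels. -/
theorem sum_term_middle_mem_hit (o f d : Fin 5) : ∑ j, term o j j f d ∈ hit 5 := by
  have hom : (varProd Finset.univ * (X f * X d ^ 2) ^ 2 : P 5).IsHomogeneous 11 := by
    have := (isHomogeneous_varProd (Finset.univ : Finset (Fin 5))).mul
      (((MvPolynomial.isHomogeneous_X (ZMod 2) f).mul
        ((MvPolynomial.isHomogeneous_X (ZMod 2) d).pow 2)).pow 2)
    simpa using this
  have := hitDeg_le_hit 5 28 (varProd_mul_sq_mem (card_allBut o) notSumTwoPow_fifteen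
    (Sq_mem_hitDeg (i := 1) (d := 12) (by norm_num) hom (by norm_num)) (by norm_num))
  rw [Sq_one_univ_mul_sq, sum_pow_char, Finset.mul_sum] at this
  convert this using 2 with j
  rw [term, levels]
  ring

/-- The relation coming from `Sq¹` in the three lowest levels. -/
theorem sum_term_bottom_mem_hit (f d : Fin 5) : ∑ j, term j j j f d ∈ hit 5 := by
  have := Sq_mem_hit (k := 5) (i := 1) (by norm_num)
    (varProd Finset.univ * (varProd Finset.univ * (X f * X d ^ 2) ^ 2) ^ 2)
  rw [Sq_one_univ_mul_sq] at this
  convert this using 2 with j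
  -- Multiplying the five variables by $x_j$ removes $x_j$ from the second level and carries it into
  -- the third; so $j$ is missing from both low levels.
  rw [← mul_assoc, X_mul_varProd (Finset.mem_univ j), term, levels, allBut]
  ring

/-- The relation coming from `Sq¹` in the two lowest levels. -/
theorem term_add_term_mem_hit {o₀ o₁ : Fin 5} (ho : o₀ ≠ o₁) (a b d : Fin 5) :
    term o₀ o₁ a b d + term o₁ o₀ a b d ∈ hit 5 := by
  obtain ⟨F, hF⟩ : ∃ F, F = (allBut o₀).erase o₁ := ⟨_, rfl⟩
  obtain ⟨r, hr, hrh⟩ : ∃ r : P 5, r = X a * X b * X d ^ 2 ∧ r.IsHomogeneous 4 :=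
    ⟨_, rfl, isHomogeneous_top a b d⟩
  have hF' : F = (allBut o₁).erase o₀ := by rw [hF, allBut, allBut, Finset.erase_right_comm]
  have m1 : o₁ ∈ allBut o₀ := by simp [allBut, ho.symm]
  have m0 : o₀ ∈ allBut o₁ := by simp [allBut, ho]
  have hFc : F.card = 3 := by rw [hF, Finset.card_erase_of_mem m1, card_allBut]
  -- $F$ consists of the variables other than $o_0,o_1$. In this $Sq^1$, the summands $j=o_0$ and
  -- $j=o_1$ complete $F$ to the four variables missing $o_1$ and $o_0$ respectively, which gives
  -- the two wanted terms.
  have hsq := Sq_mem_hit (k := 5) (i := 1) (by norm_num)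
    (varProd Finset.univ * (varProd F * r ^ 2) ^ 2)
  have hu : (Finset.univ : Finset (Fin 5)) = insert o₀ (insert o₁ F) := by
    rw [hF, Finset.insert_erase m1, allBut, Finset.insert_erase (Finset.mem_univ _)]
  rw [Sq_one_univ_mul_sq, hu, Finset.sum_insert (by simp [hF, allBut, ho]),
    Finset.sum_insert (by simp [hF]), ← add_assoc] at hsq
  -- For $j\in F$ the factor $x_j^2$ moves up a level and leaves only two variables in the second
  -- one, next to a square of a polynomial of degree 5. As $5+2=7$, this is hit in degree 12, and it
  -- lifts.
  have herr : ∑ j ∈ F, varProd (allBut j) * (X j * (varProd F * r ^ 2)) ^ 2 ∈ hit 5 := by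
    refine sum_mem fun j hj => hitDeg_le_hit 5 28 (varProd_mul_sq_mem (card_allBut j)
      notSumTwoPow_fifteen (d := 12) ?_ (by norm_num))
    obtain ⟨x, y, hxy, h⟩ := Finset.card_eq_two.mp
      (show (F.erase j).card = 2 by rw [Finset.card_erase_of_mem hj, hFc])
    rw [← mul_assoc, X_mul_varProd hj, h, varProd, Finset.prod_pair hxy, mul_assoc, ← mul_pow]
    exact two_mul_sq_mem_hitDeg x y (n := 5) ((MvPolynomial.isHomogeneous_X _ j).mul
      hrh) notSumTwoPow_seven (by norm_num)
  have h2 := (Submodule.add_mem_iff_left _ herr).mp hsq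
  have e1 : X o₁ * varProd F = varProd (allBut o₀) := by rw [hF, varProd_erase_mul m1]
  have e0 : X o₀ * varProd F = varProd (allBut o₁) := by rw [hF', varProd_erase_mul m0]
  rw [← mul_assoc, ← mul_assoc, e0, e1] at h2
  rw [term, term, levels, levels, ← hr]
  exact h2

/-! ### The projection onto the monomials containing every variable -/

/-- The substitution of zero for one variable. -/
noncomputable def killVar {k : ℕ} (j : Fin k) : P k →ₐ[ZMod 2] P k :=
  MvPolynomial.aeval fun i => if i = j then 0 else X i

theorem killVar_mem_hit {k : ℕ} (j : Fin k) {f : P k} (hf : f ∈ hit k) : killVar j f ∈ hit k := by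
  refine aeval_mem_hit (fun i => ?_) hf
  split_ifs
  · exact isLinearForm_zero
  · exact isLinearForm_X i

theorem killVar_toPoly {k : ℕ} (j : Fin k) (a : Mon k) :
    killVar j (toPoly a) = if a j = 0 then toPoly a else 0 := by
  have h : killVar j (toPoly a) = ∏ i, (if i = j then 0 else X i : P k) ^ a i := by
    rw [toPoly_eq_prod, map_prod]
    refine Finset.prod_congr rfl fun i _ => ?_
    rw [map_pow, killVar, MvPolynomial.aeval_X]
  rw [h]
  split_ifs with h0
  · rw [toPoly_eq_prod]
    refine Finset.prod_congr rfl fun i _ => ?_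
    by_cases hi : i = j
    · rw [hi, h0, pow_zero, pow_zero]
    · rw [if_neg hi]
  · refine Finset.prod_eq_zero (Finset.mem_univ j) ?_
    rw [if_pos rfl, zero_pow h0]

/-- The projection that kills the monomials in which some variable of the list is missing. -/
noncomputable def keepVars {k : ℕ} : List (Fin k) → P k →ₗ[ZMod 2] P k
  | [] => LinearMap.id
  | j :: l => (LinearMap.id - (killVar j).toLinearMap).comp (keepVars l)

theorem keepVars_mem_hit {k : ℕ} (l : List (Fin k)) {f : P k} (hf : f ∈ hit k) :
    keepVars l f ∈ hit k := by
  induction l with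
  | nil => exact hf
  | cons j l ih => exact sub_mem ih (killVar_mem_hit j ih)

theorem keepVars_toPoly {k : ℕ} (l : List (Fin k)) (a : Mon k) :
    keepVars l (toPoly a) = if ∀ j ∈ l, 0 < a j then toPoly a else 0 := by
  induction l with
  | nil => simp [keepVars]
  | cons j l ih =>
    rw [keepVars, LinearMap.comp_apply, ih]
    by_cases h : ∀ i ∈ l, 0 < a i
    · rw [if_pos h]
      simp only [LinearMap.sub_apply, LinearMap.id_apply, AlgHom.toLinearMap_apply,
        killVar_toPoly]
      by_cases hj : a j = 0
      · simp [hj]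
      · rw [if_neg hj, if_pos, sub_zero]
        intro i hi
        rcases List.mem_cons.mp hi with rfl | hi
        · omega
        · exact h i hi
    · rw [if_neg h, map_zero, if_neg]
      exact fun h' => h fun i hi => h' i (List.mem_cons_of_mem _ hi)

/-- The projection onto `P_k^+`. -/
noncomputable def plusProj (k : ℕ) : P k →ₗ[ZMod 2] P k := keepVars (List.finRange k)

theorem plusProj_mem_hit {k : ℕ} {f : P k} (hf : f ∈ hit k) : plusProj k f ∈ hit k :=
  keepVars_mem_hit _ hf

theorem plusProj_toPoly {k : ℕ} (a : Mon k) :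
    plusProj k (toPoly a) = if ∀ j, 0 < a j then toPoly a else 0 := by
  rw [plusProj, keepVars_toPoly]
  simp

theorem plusProj_of_mem {k : ℕ} {f : P k} (hf : f ∈ PPlus k) : plusProj k f = f := by
  induction hf using Submodule.span_induction with
  | mem x hx =>
    obtain ⟨a, ha, rfl⟩ := hx
    rw [plusProj_toPoly]
    exact if_pos ha
  | zero => simp
  | add x y _ _ hx hy => rw [map_add, hx, hy]
  | smul r x _ hx => rw [map_smul, hx]

/-! ### The monomials of weight `(4, 4, 2, 1)` -/

theorem exists_levels {k : ℕ} {a : Mon k} (ha : weight a = omegaBar 5 3) :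
    ∃ (J₀ J₁ : Finset (Fin k)) (x y d : Fin k), J₀.card = 4 ∧ J₁.card = 4 ∧ x < y ∧
      toPoly a = levels J₀ J₁ x y d := by
  have w : ∀ i, weight a i = _ := fun i => (DFunLike.congr_fun ha i).trans (omegaBar_apply i)
  have e0 := weight_zero_eq a
  have e1 := weight_zero_eq (half a)
  have e2 := weight_zero_eq (half (half a))
  have e3 := weight_zero_eq (half (half (half a)))
  simp only [weight_half, w] at e0 e1 e2 e3
  simp at e0 e1 e2 e3
  obtain ⟨x, y, hxy, h2⟩ := Finset.card_eq_two.mp e2.symm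
  obtain ⟨d, h3⟩ := Finset.card_eq_one.mp e3.symm
  have e4 : half (half (half (half a))) = 0 := by
    -- The weight has no entries beyond the fourth, so nothing remains above the four levels.
    have hw : ∀ i, weight (half (half (half (half a)))) i = 0 := by
      intro i
      simp only [weight_half, w]
      simp
    have hz : ∀ n (b : Mon k), (∀ i, weight b i = 0) → b.degree ≤ n → b = 0 := by
      intro n
      induction n with
      | zero =>
        intro b _ hb
        exact (Finsupp.degree_eq_zero_iff b).mp (by omega)
      | succ n ih =>
        intro b hb hd
        have c1 := degree_eq_card_add b
        have c2 := weight_zero_eq b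
        rw [hb 0] at c2
        have h0 := ih (half b) (fun i => by rw [weight_half]; exact hb _) (by omega)
        rw [h0, map_zero] at c1
        exact (Finsupp.degree_eq_zero_iff b).mp (by omega)
    exact hz _ _ hw le_rfl
  have main : toPoly a = levels (oddVars a) (oddVars (half a)) x y d := by
    rw [toPoly_eq_varProd_mul a, toPoly_eq_varProd_mul (half a),
      toPoly_eq_varProd_mul (half (half a)), toPoly_eq_varProd_mul (half (half (half a))), e4, h2,
      h3, levels, varProd.eq_1 {x, y}, varProd.eq_1 {d}, Finset.prod_pair hxy,
      Finset.prod_singleton]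
    simp [toPoly]
  rcases lt_or_gt_of_ne hxy with h | h
  · exact ⟨_, _, x, y, d, e0.symm, e1.symm, h, main⟩
  · exact ⟨_, _, y, x, d, e0.symm, e1.symm, h, main.trans (levels_swap _ _ _ _ _)⟩

theorem exists_term {a : Mon 5} (ha : weight a = omegaBar 5 3) :
    ∃ o₀ o₁ x y d : Fin 5, x < y ∧ toPoly a = term o₀ o₁ x y d := by
  obtain ⟨J₀, J₁, x, y, d, h₀, h₁, hxy, h⟩ := exists_levels ha
  have aux : ∀ J : Finset (Fin 5), J.card = 4 → ∃ o, J = allBut o := by decide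
  obtain ⟨o₀, rfl⟩ := aux J₀ h₀
  obtain ⟨o₁, rfl⟩ := aux J₁ h₁
  exact ⟨o₀, o₁, x, y, d, hxy, h⟩

end HitProblem

/-! ### The spike $(15,7,3,3)$ and products of minors. -/

namespace HitProblem

open MvPolynomial (X)

/-! ### Functionals vanishing on hit polynomials -/

/-- The squarefree monomial with the variables of a list without repetitions. -/
noncomputable def listMon (l : List (Fin 4)) : Mon 4 := (l.map fun i => Finsupp.single i 1).sum

/-- The exponent vector `(15, 7, 3, 3)`. -/
noncomputable def spike : Mon 4 :=
  listMon [0, 1, 2, 3] + 2 • (listMon [0, 1, 2, 3] + 2 • (listMon [0, 1] + 2 • listMon [0]))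

theorem spike_apply (j : Fin 4) : spike j = ![15, 7, 3, 3] j := by
  fin_cases j <;> simp [spike, listMon]

/-- All exponents of the spike are of the form $2^s-1$. A contribution to its coefficient carries
factors $\binom{m}{2^s-1-m}$; the two entries have complementary binary digits, so this is even for
$m<2^s-1$, and some variable is in that case because $i>0$. -/
theorem coeff_spike_Sq {i : ℕ} (hi : 0 < i) (f : P 4) : (Sq 4 i f).coeff spike = 0 := by
  rw [toPoly_mem_span f, map_sum, MvPolynomial.coeff_sum]
  refine Finset.sum_eq_zero fun a _ => ?_
  rw [Sq_toPoly, MvPolynomial.coeff_sum]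
  refine Finset.sum_eq_zero fun p _ => ?_
  split_ifs with h
  · rw [MvPolynomial.coeff_monomial]
    split_ifs with hs
    · have hj : ∃ j, 0 < p j := by
        by_contra hno
        push Not at hno
        rw [Finset.sum_eq_zero fun j _ => Nat.le_zero.mp (hno j)] at h
        omega
      obtain ⟨j, hj⟩ := hj
      refine Finset.prod_eq_zero (Finset.mem_univ j) ?_
      have hsj : a j + p j = ![15, 7, 3, 3] j := by
        rw [← spike_apply, ← hs]
        simp
      have even : ∀ s ∈ [15, 7, 3], ∀ m < s, m.choose (s - m) % 2 = 0 := by decide +kernel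
      have hmem : ![15, 7, 3, 3] j ∈ [15, 7, 3] := by fin_cases j <;> simp
      have := even _ hmem (a j) (by omega)
      rw [show ![15, 7, 3, 3] j - a j = p j by omega] at this
      exact (ZMod.natCast_eq_zero_iff _ _).mpr (Nat.dvd_of_mod_eq_zero this)
    · rfl
  · rfl

/-- The linear form whose coefficients are the binary digits of `c`. -/
noncomputable def linForm (c : ℕ) : P 4 := ∑ i : Fin 4, if c.testBit i then X i else 0

theorem isLinearForm_sum {k : ℕ} {ι : Type*} (s : Finset ι) (L : ι → P k)
    (h : ∀ i ∈ s, IsLinearForm (L i)) : IsLinearForm (∑ i ∈ s, L i) :=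
  Finset.sum_induction L IsLinearForm (fun _ _ => IsLinearForm.add) isLinearForm_zero h

theorem isLinearForm_linForm (c : ℕ) : IsLinearForm (linForm c) := by
  refine isLinearForm_sum _ _ fun i _ => ?_
  split_ifs
  · exact isLinearForm_X i
  · exact isLinearForm_zero

theorem isHomogeneous_linForm (c : ℕ) : (linForm c).IsHomogeneous 1 := by
  refine MvPolynomial.IsHomogeneous.sum _ _ _ fun i _ => ?_
  split_ifs
  · exact MvPolynomial.isHomogeneous_X _ i
  · exact MvPolynomial.isHomogeneous_zero _ _ _

/-- The coefficient of the monomial `spike` after a linear substitution. -/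
noncomputable def spikeFun {k : ℕ} (g : Fin k → ℕ) : P k →ₗ[ZMod 2] ZMod 2 :=
  (MvPolynomial.lcoeff (ZMod 2) spike).comp
    (MvPolynomial.aeval fun j => linForm (g j)).toLinearMap

theorem spikeFun_apply {k : ℕ} (g : Fin k → ℕ) (f : P k) :
    spikeFun g f = (MvPolynomial.aeval (fun j => linForm (g j)) f).coeff spike := rfl

theorem spikeFun_eq_zero {k : ℕ} (g : Fin k → ℕ) {f : P k} (hf : f ∈ hit k) :
    spikeFun g f = 0 := by
  have : hit k ≤ LinearMap.ker (spikeFun g) := by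
    refine hit_le fun i hi f => ?_
    rw [LinearMap.mem_ker, spikeFun_apply, ← Sq_aeval fun j => isLinearForm_linForm _]
    exact coeff_spike_Sq hi _
  exact this hf

theorem listMon_cons (i : Fin 4) (l : List (Fin 4)) :
    listMon (i :: l) = Finsupp.single i 1 + listMon l := by simp [listMon]

theorem listMon_apply (l : List (Fin 4)) (i : Fin 4) : listMon l i = l.count i := by
  induction l with
  | nil => simp [listMon]
  | cons j l ih =>
    rw [listMon_cons, Finsupp.add_apply, ih, List.count_cons, Finsupp.single_apply]
    by_cases h : j = i <;> simp [h, add_comm]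

theorem listMon_degree (l : List (Fin 4)) : (listMon l).degree = l.length := by
  induction l with
  | nil => simp [listMon]
  | cons j l ih =>
    rw [listMon_cons, map_add, ih, Finsupp.degree_single, List.length_cons, add_comm]

/-- The minor of the columns given by binary digits, on the given rows; the empty product of
linear forms has the coefficient `1` at the empty list only. -/
def minor : List ℕ → List (Fin 4) → Bool
  | [], rows => rows.isEmpty
  | c :: cs, rows =>
    rows.foldr (fun (i : Fin 4) b => xor (c.testBit i.val && minor cs (rows.erase i)) b) false

/-- A truth value as an element of `F_2`. -/
def bitVal (b : Bool) : ZMod 2 := if b then 1 else 0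

theorem bitVal_xor (a b : Bool) : bitVal (xor a b) = bitVal a + bitVal b := by
  revert a b; decide

theorem bitVal_and (a b : Bool) : bitVal (a && b) = bitVal a * bitVal b := by
  revert a b; decide

theorem bitVal_foldr_xor {α : Type*} (p : α → Bool) (l : List α) :
    bitVal (l.foldr (fun i b => xor (p i) b) false) = (l.map fun i => bitVal (p i)).sum := by
  induction l with
  | nil => rfl
  | cons i l ih => rw [List.foldr_cons, bitVal_xor, ih, List.map_cons, List.sum_cons]

theorem coeff_listMon_X_mul (i : Fin 4) (l : List (Fin 4)) (q : P 4) :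
    (X i * q).coeff (listMon l) = if i ∈ l then q.coeff (listMon (l.erase i)) else 0 := by
  simp only [MvPolynomial.coeff_X_mul', Finsupp.mem_support_iff, listMon_apply]
  by_cases h : i ∈ l
  · rw [if_pos h, if_pos (Nat.pos_iff_ne_zero.mp (List.count_pos_iff.mpr h))]
    congr 1
    have : listMon l = Finsupp.single i 1 + listMon (l.erase i) := by
      rw [← listMon_cons]
      exact List.Perm.sum_eq ((List.perm_cons_erase h).map _)
    rw [this, add_tsub_cancel_left]
  · rw [if_neg h, if_neg]
    exact fun h0 => h0 (List.count_eq_zero_of_not_mem h)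

/-- The coefficient of a squarefree monomial in a product of linear forms is a permanent, which
modulo two is a determinant; `minor` is its expansion along the first column, without signs. -/
theorem coeff_listMon_prod (cs : List ℕ) (rows : List (Fin 4)) (h : rows.Nodup) :
    ((cs.map linForm).prod).coeff (listMon rows) = bitVal (minor cs rows) := by
  induction cs generalizing rows with
  | nil =>
    rw [List.map_nil, List.prod_nil, MvPolynomial.coeff_one]
    cases rows with
    | nil => simp [listMon, minor, bitVal]
    | cons i l =>
      rw [if_neg]
      · simp [minor, bitVal]
      · intro h0
        have := congrArg Finsupp.degree h0
        rw [listMon_degree] at this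
        simp at this
  | cons c cs ih =>
    rw [minor, bitVal_foldr_xor, List.map_cons, List.prod_cons, linForm, Finset.sum_mul,
      MvPolynomial.coeff_sum, ← List.sum_toFinset _ h]
    rw [← Finset.sum_subset (Finset.subset_univ rows.toFinset)]
    · refine Finset.sum_congr rfl fun i hi => ?_
      rw [bitVal_and, ← ih _ (h.erase i)]
      by_cases hc : c.testBit i
      · rw [if_pos hc, coeff_listMon_X_mul, if_pos (List.mem_toFinset.mp hi), hc]
        simp [bitVal]
      · rw [if_neg hc]
        simp [bitVal, hc]
    · intro i _ hi
      split_ifs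
      · rw [coeff_listMon_X_mul, if_neg fun h => hi (List.mem_toFinset.mpr h)]
      · simp

theorem sq_coeff_two_smul (h : P 4) (e : Mon 4) : (h ^ 2).coeff (2 • e) = h.coeff e := by
  rw [← MvPolynomial.expand_zmod, MvPolynomial.coeff_expand_smul _ (by norm_num)]

/-- Exponents in $h^2$ are even, so the factor from $y$ must be divisible by the squarefree monomial
of $l$; equality of degrees then forces it to be that monomial. This splits off one binary level. -/
theorem coeff_mul_sq {y h : P 4} {l : List (Fin 4)} (hl : l.Nodup) (hy : y.IsHomogeneous l.length)
    (e : Mon 4) :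
    (y * h ^ 2).coeff (listMon l + 2 • e) = y.coeff (listMon l) * h.coeff e := by
  rw [MvPolynomial.coeff_mul, Finset.sum_eq_single (listMon l, 2 • e)]
  · rw [sq_coeff_two_smul]
  · rintro ⟨p, q⟩ hpq hne
    rw [Finset.HasAntidiagonal.mem_antidiagonal] at hpq
    by_contra hnz
    obtain ⟨hp, hq⟩ := mul_ne_zero_iff.mp hnz
    have hdeg : p.degree = l.length := by
      have := hy hp
      rw [Finsupp.degree_eq_weight_one (R := ℕ)]
      exact this
    have hev : ∀ i, 2 ∣ q i := by
      by_contra hno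
      push Not at hno
      obtain ⟨i, hi⟩ := hno
      rw [← MvPolynomial.expand_zmod] at hq
      exact hq (MvPolynomial.coeff_expand_of_not_dvd _ hi)
    have hle : listMon l ≤ p := by
      intro i
      have h1 := DFunLike.congr_fun hpq i
      simp only [Finsupp.add_apply, Finsupp.smul_apply, smul_eq_mul] at h1
      have h2 := hev i
      have h3 : listMon l i ≤ 1 := by
        rw [listMon_apply]
        exact List.nodup_iff_count_le_one.mp hl i
      omega
    obtain ⟨r, rfl⟩ := exists_add_of_le hle
    rw [map_add, listMon_degree] at hdeg
    have hr : r = 0 := (Finsupp.degree_eq_zero_iff r).mp (by omega)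
    subst hr
    rw [add_zero] at hpq hne
    exact hne (Prod.ext rfl (add_left_cancel hpq))
  · intro h
    simp at h

theorem aeval_varProd {k : ℕ} (g : Fin k → ℕ) {l : List (Fin k)} (hl : l.Nodup) :
    MvPolynomial.aeval (fun j => linForm (g j)) (varProd l.toFinset)
      = ((l.map g).map linForm).prod := by
  rw [varProd, map_prod, List.prod_toFinset _ hl, List.map_map]
  simp [Function.comp_def]

theorem isHomogeneous_prod_linForm (cs : List ℕ) :
    ((cs.map linForm).prod).IsHomogeneous cs.length := by
  induction cs with
  | nil => simpa using MvPolynomial.isHomogeneous_one _ _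
  | cons c cs ih =>
    rw [List.map_cons, List.prod_cons, List.length_cons, add_comm]
    exact (isHomogeneous_linForm c).mul ih

/-- The value of the functional on a monomial of weight `(4, 4, 2, 1)` is a product of minors. -/
theorem spikeFun_levels {k : ℕ} (g : Fin k → ℕ) {l₀ l₁ : List (Fin k)} (h₀ : l₀.Nodup)
    (h₁ : l₁.Nodup) (c₀ : l₀.length = 4) (c₁ : l₁.length = 4) (a b d : Fin k) :
    spikeFun g (levels l₀.toFinset l₁.toFinset a b d) =
      bitVal (minor (l₀.map g) [0, 1, 2, 3] && (minor (l₁.map g) [0, 1, 2, 3] &&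
        (minor [g a, g b] [0, 1] && minor [g d] [0]))) := by
  have hn : [(0 : Fin 4), 1, 2, 3].Nodup := by decide
  have hp := fun cs => isHomogeneous_prod_linForm cs
  rw [spikeFun_apply, levels]
  simp only [map_mul, map_pow, aeval_varProd g h₀, aeval_varProd g h₁, MvPolynomial.aeval_X]
  -- The levels of the spike have the sizes 4, 4, 2, 1 of those of the monomial, so the coefficient
  -- factors level by level.
  rw [spike, coeff_mul_sq hn (by simpa [c₀] using hp (l₀.map g)),
    coeff_mul_sq hn (by simpa [c₁] using hp (l₁.map g)),
    coeff_mul_sq (by decide) ((isHomogeneous_linForm _).mul (isHomogeneous_linForm _))]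
  simp only [bitVal_and]
  rw [coeff_listMon_prod _ _ hn, coeff_listMon_prod _ _ hn,
    ← coeff_listMon_prod [g a, g b] _ (by decide), ← coeff_listMon_prod [g d] _ (by decide)]
  simp

end HitProblem

/-! ### Encoding of monomials, relations and functionals as numbers and binary masks. -/

namespace HitProblem

/-! ### Computable counterparts -/

/-- Evaluates the argument before it is passed on. -/
def force {α : Type*} (n : ℕ) (f : ℕ → α) : α :=
  Nat.casesOn n (f 0) fun m => f (Nat.succ m)

theorem force_eq {α : Type*} (n : ℕ) (f : ℕ → α) : force n f = f n := by cases n <;> rfl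

/-- Evaluates the entries of a list before it is passed on. -/
def forceList {α : Type*} : List ℕ → (List ℕ → α) → α
  | [], f => f []
  | a :: l, f => force a fun b => forceList l fun t => f (b :: t)

theorem forceList_eq {α : Type*} (l : List ℕ) (f : List ℕ → α) : forceList l f = f l := by
  induction l generalizing f with
  | nil => rfl
  | cons a l ih => rw [forceList, force_eq, ih]

/-- The mask of a formal sum over `F_2`. -/
def sumMask : List ℕ → ℕ
  | [] => 0
  | n :: l => force (sumMask l) fun m => Nat.xor m (Nat.shiftLeft 1 n)

/-- The mask of a set. -/
def maskOf : List ℕ → ℕ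
  | [] => 0
  | n :: l => force (maskOf l) fun m => Nat.lor m (Nat.shiftLeft 1 n)

/-- If at most one digit of `w` is unknown, it becomes known. -/
def learn (known w : ℕ) : ℕ :=
  force (Nat.xor w (Nat.land w known)) fun u =>
    Nat.casesOn (Nat.land u (Nat.pred u)) (Nat.lor known w) fun _ => known

/-- Propagation through a list of relations: each one that has become determined up to a single
digit fixes that digit for those that follow. -/
def learnAll : List ℕ → ℕ → ℕ
  | [], known => known
  | w :: l, known => force (learn known w) fun known' => learnAll l known'

/-- Later relations can determine digits that earlier ones lacked, so the pass is repeated. -/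
def learnRepeat (l : List ℕ) : ℕ → ℕ → ℕ
  | 0, known => known
  | n + 1, known => force (learnAll l known) fun known' => learnRepeat l n known'

/-- Elimination of the leading digits of the rows of a list, the last row first. -/
def reduceMask (l : List (ℕ × ℕ)) (w : ℕ) : ℕ :=
  List.rec w (fun pm _ v => force v fun v =>
    Nat.xor v (Nat.mul pm.2 (Nat.mod (Nat.shiftRight v pm.1) 2))) l

/-- Gaussian elimination; every row is stored with the index of its leading digit. -/
def eliminate : List ℕ → List (ℕ × ℕ) → List (ℕ × ℕ)
  | [], acc => acc
  | w :: l, acc =>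
    force w fun w => force (reduceMask acc w) fun v => force v.log2 fun p => eliminate l ((p, v) :: acc)

/-! #### The monomials of weight `(4, 4, 2, 1)` -/

/-- The code of a term; the third and the fourth entry are interchangeable. -/
def termCode (o₀ o₁ a b d : ℕ) : ℕ :=
  if a ≤ b then o₀ * 625 + o₁ * 125 + a * 25 + b * 5 + d
  else o₀ * 625 + o₁ * 125 + b * 25 + a * 5 + d

/-- The digit of index `i` in base five. -/
def digit (i n : ℕ) : ℕ := n / 5 ^ i % 5

/-- The exponents of the monomial with the given code. -/
def codeExps (n : ℕ) : List ℕ :=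
  (List.range 5).map fun j =>
    (if j = digit 4 n then 0 else 1) + 2 * (if j = digit 3 n then 0 else 1)
      + 4 * ((if j = digit 2 n then 1 else 0) + (if j = digit 1 n then 1 else 0))
      + 8 * (if j = digit 0 n then 1 else 0)

/-- The code of a monomial. -/
def codeOf (l : List ℕ) : ℕ :=
  let level t v := (List.range 5).filter fun j => alpha t (l.getD j 0) = v
  termCode ((level 0 0).getD 0 0) ((level 1 0).getD 0 0) ((level 2 1).getD 0 0)
    ((level 2 1).getD 1 0) ((level 3 1).getD 0 0)

def allCodes : List ℕ :=
  (List.range 5).flatMap fun o₀ => (List.range 5).flatMap fun o₁ => (List.range 5).flatMap fun a =>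
    (List.range 5).flatMap fun b => (List.range 5).map fun d => termCode o₀ o₁ a b d

/-- The formal sums of codes that represent hit polynomials. -/
def relations : List (List ℕ) :=
  ((List.range 5).flatMap fun o₀ => (List.range o₀).flatMap fun o₁ =>
    (List.range 5).flatMap fun b => (List.range b).flatMap fun a => (List.range 5).map fun d =>
      [termCode o₀ o₁ a b d, termCode o₁ o₀ a b d]) ++
  ((List.range 5).flatMap fun o₀ => (List.range 5).flatMap fun o₁ =>
    (List.range 5).flatMap fun c => (List.range c).flatMap fun b => (List.range b).map fun a =>
      [termCode o₀ o₁ b c a, termCode o₀ o₁ a c b, termCode o₀ o₁ a b c]) ++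
  ((List.range 5).flatMap fun o => (List.range 5).flatMap fun f => (List.range 5).map fun d =>
    (List.range 5).map fun j => termCode o j j f d) ++
  ((List.range 5).flatMap fun f => (List.range 5).map fun d =>
    (List.range 5).map fun j => termCode j j j f d)

/-! #### The maps `φ` -/

/-- All sublists. -/
def subs : List ℕ → List (List ℕ)
  | [] => [[]]
  | a :: l => subs l ++ (subs l).map (a :: ·)

/-- Compatibility, for exponent lists; the indices of the variables are counted from zero. -/
def compatList (I x : List ℕ) (u : ℕ) : Bool :=
  (List.range I.length).all fun t =>
    (!decide (t < u) || x.getD (I.getD t 0 - 1) 0 == 2 ^ I.length - 1) &&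
    (!decide (u < t) || alpha (I.length - 1 - t) (x.getD (I.getD t 0 - 1) 0) == 1) &&
    (!decide (t ≤ u) || alpha (I.length - 1 - t) (x.getD (I.getD u 0 - 1) 0) == 1) &&
    decide (2 ^ I.length - 1 < x.getD (I.getD u 0 - 1) 0)

/-- The exponents of `φ_{(i;I)}(x)` when `x` is `u`-compatible. -/
def phiExps (i : ℕ) (I x : List ℕ) (u : ℕ) : List ℕ :=
  (List.range 5).map fun j =>
    (if j = i then 2 ^ I.length - 1 else 0)
      + (if j < i then x.getD j 0 else if j = i then 0 else x.getD (j - 1) 0)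
      - ((if j = I.getD u 0 then
            (((List.range I.length).filter (· ≤ u)).map fun t => 2 ^ (I.length - 1 - t)).sum else 0)
        + (((List.range I.length).filter (u < ·)).map fun t =>
            if j = I.getD t 0 then 2 ^ (I.length - 1 - t) else 0).sum)

def phiList (i : ℕ) (I x : List ℕ) : Option (List ℕ) :=
  ((List.range I.length).find? (compatList I x)).map (phiExps i I x)

/-- The index pairs `(i; I)` with `I` nonempty. -/
def indexPairs : List (ℕ × List ℕ) :=
  (List.range 5).flatMap fun i =>
    ((subs ((List.range 5).filter (i < ·))).filter (· ≠ [])).map fun I => (i, I)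

/-- The levels `({a, b}, d)` of the monomials of weight `(4, 4, 2, 1)` in four variables. -/
def topLevels : List (ℕ × ℕ × ℕ) :=
  (List.range 4).flatMap fun b => (List.range b).flatMap fun a =>
    (List.range 4).map fun d => (a, b, d)

def topExps (t : ℕ × ℕ × ℕ) : List ℕ :=
  (List.range 4).map fun j =>
    3 + 4 * ((if j = t.1 then 1 else 0) + (if j = t.2.1 then 1 else 0))
      + 8 * (if j = t.2.2 then 1 else 0)

/-- The admissible monomials of weight `(4, 4, 2, 1)` in four variables. -/
def basisFour : List (List ℕ) := (topLevels.filter fun t => t.1 ≤ t.2.2).map topExps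

def phiPlusList : List (List ℕ) :=
  indexPairs.flatMap fun p => (basisFour.filterMap (phiList p.1 p.2)).filter fun l =>
    l.all (0 < ·)

def extraList : List (List ℕ) :=
  [[7, 9, 2, 3, 7], [7, 9, 2, 7, 3], [7, 9, 3, 2, 7], [7, 9, 3, 7, 2], [7, 9, 7, 2, 3],
    [7, 9, 7, 3, 2], [3, 7, 11, 4, 3], [7, 3, 11, 4, 3], [7, 11, 3, 4, 3], [7, 9, 3, 3, 6],
    [7, 9, 3, 6, 3], [3, 7, 7, 8, 3], [3, 7, 8, 3, 7], [3, 7, 8, 7, 3], [7, 3, 7, 8, 3],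
    [7, 3, 8, 3, 7], [7, 3, 8, 7, 3], [7, 7, 3, 8, 3], [7, 7, 8, 3, 3]]

def dedup : List ℕ → ℕ → List ℕ
  | [], _ => []
  | n :: l, seen => if seen.testBit n then dedup l seen
    else n :: force (seen ||| 1 <<< n) fun seen' => dedup l seen'

/-- The codes of the 355 monomials. -/
def basisCodes : List ℕ := dedup ((phiPlusList ++ extraList).map codeOf) 0

/-- The column with index `j` of the matrix whose columns are the digits of `g` in base sixteen. -/
def column (g j : ℕ) : ℕ := g / 16 ^ j % 16

/-- The codes of the functionals that are evaluated on the monomials. -/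
def functionals : List ℕ := [
  144260, 145428, 145444, 145447, 145460, 145463, 145473, 145474, 145475, 145476, 145477, 145478,
  145479, 145480, 145481, 145482, 145483, 145521, 145522, 145523, 145524, 145525, 145526, 145527,
  145528, 145530, 145531, 145533, 145535, 145540, 145543, 145588, 146212, 146228, 146242, 146243,
  146244, 146246, 146247, 146248, 146249, 146250, 146251, 146253, 146255, 146308, 146324, 146356,
  164404, 164407, 164419, 164628, 164644, 164647, 164660, 164663, 164673, 164674, 164675, 164676,
  164677, 164678, 164679, 164680, 164681, 164682, 164683, 164721, 164722, 164723, 164724, 164725,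
  164726, 164727, 164728, 164730, 164731, 164733, 164735, 164740, 164743, 164788, 164899, 164913,
  164914, 164915, 164916, 164917, 164918, 164919, 164920, 164921, 164922, 164923, 164931, 164963,
  164995, 165027, 165940, 165943, 165955, 205700, 206868, 206884, 206887, 206900, 206903, 206913,
  206914, 206915, 206916, 206917, 206918, 206919, 206920, 206921, 206922, 206923, 206961, 206962,
  206963, 206964, 206965, 206966, 206967, 206968, 206970, 206971, 206973, 206975, 206980, 206983,
  207028, 207652, 207668, 207682, 207683, 207684, 207686, 207687, 207688, 207689, 207690, 207691,
  207693, 207695, 207748, 207764, 207796, 229908, 229911, 229924, 229927, 229940, 229943, 229953,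
  229954, 229955, 229956, 229957, 229958, 229959, 229960, 229961, 229962, 229963, 230001, 230002,
  230003, 230004, 230005, 230006, 230007, 230008, 230010, 230011, 230013, 230015, 230020, 230023,
  230068, 230180, 230183, 230210, 230433, 230434, 230435, 230436, 230437, 230438, 230439, 230440,
  230441, 230442, 230443, 230450, 230466, 230514, 230530, 230578, 231460, 231463, 231490, 533044,
  533047, 533059, 533268, 533271, 533284, 533287, 533300, 533303, 533313, 533314, 533315, 533316,
  533317, 533318, 533319, 533320, 533321, 533322, 533323, 533361, 533362, 533363, 533364, 533365,
  533366, 533367, 533368, 533370, 533371, 533373, 533375, 533380, 533383, 533428, 533539, 533553,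
  533554, 533555, 533556, 533557, 533558, 533559, 533560, 533561, 533562, 533563, 533571, 533603,
  533635, 533667, 534580, 534583, 534595, 537108, 537111, 537124, 537127, 537140, 537143, 537153,
  537154, 537155, 537156, 537157, 537158, 537159, 537160, 537161, 537162, 537163, 537201, 537202,
  537203, 537204, 537205, 537206, 537207, 537208, 537210, 537211, 537213, 537215, 537220, 537223,
  537268, 537380, 537383, 537410, 537633, 537634, 537635, 537636, 537637, 537638, 537639, 537640,
  537641, 537642, 537643, 537650, 537666, 537714, 537730, 537778, 538660, 538663, 538690, 541219,
  541233, 541234, 541235, 541236, 541237, 541238, 541239, 541240, 541241, 541242, 541243, 541251,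
  541283, 541315, 541347, 541473, 541474, 541475, 541476, 541477, 541478, 541479, 541480, 541481,
  541482, 541483, 541490, 541506, 541554, 541570, 541618, 541731, 541746, 542755, 542770, 557620,
  557623, 557635, 557860, 557863, 557890, 558115, 558130]

/-- The digits at the positions of the elements of the list that satisfy `p`. -/
def filterMask (p : ℕ → Bool) : List ℕ → ℕ
  | [] => 0
  | t :: l => force (filterMask p l) fun m => 2 * m + (p t).toNat

/-- The union of the masks of the selected indices. -/
def unionMask (sel : ℕ → Bool) (masks : List ℕ) : List ℕ → ℕ
  | [] => 0
  | i :: l => force (unionMask sel masks l) fun m =>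
      Bool.casesOn (sel i) m (Nat.lor m (masks.getD i 0))

def colsBut (g o : ℕ) : List ℕ := ((List.range 5).filter (· ≠ o)).map (column g)

/-- The masks of the level sets of a function with values less than `n`. -/
def levelMasks (n : ℕ) (f : ℕ → ℕ) (l : List ℕ) : List ℕ :=
  (List.range n).map fun o => filterMask (fun t => f t == o) l

/-- The values of a functional on the monomials of a list with the given level masks. -/
def functionalMask (m₀ m₁ m₂ m₃ : List ℕ) (g : ℕ) : ℕ :=
  Nat.land (unionMask (fun o => minor (colsBut g o) [0, 1, 2, 3]) m₀ (List.range 5))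
    (Nat.land (unionMask (fun o => minor (colsBut g o) [0, 1, 2, 3]) m₁ (List.range 5))
    (Nat.land (unionMask (fun o => minor [column g (o / 5), column g (o % 5)] [0, 1]) m₂
      (List.range 25))
    (unionMask (fun o => minor [column g o] [0]) m₃ (List.range 5))))

/-- The values of the functionals on the monomials of a list. The twenty lowest digits only serve
to tell the numerals apart. -/
def functionalMasks (l : List ℕ) : List ℕ :=
  forceList (levelMasks 5 (digit 4) l) fun m₀ => forceList (levelMasks 5 (digit 3) l) fun m₁ =>
  forceList (levelMasks 25 (fun t => digit 2 t * 5 + digit 1 t) l) fun m₂ =>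
  forceList (levelMasks 5 (digit 0) l) fun m₃ => functionals.map fun g =>
    Nat.add (Nat.mul (functionalMask m₀ m₁ m₂ m₃ g) (2 ^ 20)) g

/-- The weight of the monomial with the given exponents is `(4, 4, 2, 1)`. -/
def hasWeight (l : List ℕ) : Bool :=
  l.all (· < 16) && (l.map (alpha 0)).sum == 4 && (l.map (alpha 1)).sum == 4 &&
    (l.map (alpha 2)).sum == 2 && (l.map (alpha 3)).sum == 1

/-- The codes of the terms that vanish trivially or belong to the basis. -/
def startCodes : List ℕ :=
  basisCodes ++ allCodes.filter fun n => digit 2 n = digit 1 n ∨ 0 ∈ codeExps n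

/-- The round trip shows that `codeOf` loses nothing on the lists in use, and that its default
values are harmless there. -/
theorem codeExps_codeOf : ∀ l ∈ phiPlusList ++ extraList, codeExps (codeOf l) = l := by
  decide +kernel

theorem basisCodes_check : basisCodes.length = 355 ∧
    ∀ n ∈ basisCodes, (hasWeight (codeExps n) && (codeExps n).all (0 < ·)) = true := by
  decide +kernel

/-- No elimination is needed: from the starting set, eight passes of single-unknown propagation
reach every code. -/
theorem spanning_check : allCodes.all (Nat.testBit
    (learnRepeat (relations.map sumMask) 8 (maskOf startCodes))) = true := by
  decide +kernel

/-- Each row is cleared at the leading digits of all older rows, and the newest row stands first.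
Hence a row involves, besides its own leading digit, only those of newer rows, already known, and a
single pass is back substitution. The total 375 is $20+355$: the twenty lowest digits count as known
from the start. -/
theorem independence_check : forceList basisCodes (fun l =>
    learnAll ((eliminate (functionalMasks l) []).map Prod.snd) (2 ^ 20 - 1)) = 2 ^ 375 - 1 := by
  decide +kernel

end HitProblem

/-! ### Soundness of propagation and elimination; decoding of codes. -/

namespace HitProblem

/-! ### Soundness of the computations with masks -/

theorem casesOn_eq_ite (u x y : ℕ) :
    (Nat.casesOn (motive := fun _ => ℕ) u x fun _ => y) = if u = 0 then x else y := by
  cases u <;> simp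

section Masks

set_option linter.unusedSectionVars false

variable {M : Type*} [AddCommGroup M] [Module (ZMod 2) M] (N : Submodule (ZMod 2) M) (val : ℕ → M)
  (n : ℕ)

/-- The sum of the values at the digits of a mask. -/
def bitSum (w : ℕ) : M := ∑ i ∈ Finset.range n, if w.testBit i then val i else 0

/-- All values at the digits of a mask lie in the submodule. -/
def AllIn (w : ℕ) : Prop := ∀ i < n, w.testBit i = true → val i ∈ N

theorem bitSum_xor (v w : ℕ) : bitSum val n (v ^^^ w) = bitSum val n v + bitSum val n w := by
  rw [bitSum, bitSum, bitSum, ← Finset.sum_add_distrib]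
  refine Finset.sum_congr rfl fun i _ => ?_
  rw [Nat.testBit_xor]
  cases v.testBit i <;> cases w.testBit i <;> simp [ZModModule.add_self]

theorem bitSum_zero : bitSum val n 0 = 0 := by simp [bitSum]

theorem bitSum_one_shiftLeft {i : ℕ} (hi : i < n) : bitSum val n (1 <<< i) = val i := by
  rw [bitSum, Nat.one_shiftLeft, Finset.sum_eq_single i]
  · simp
  · intro j _ hj
    rw [Nat.testBit_two_pow]
    simp [hj.symm]
  · intro h
    exact absurd (Finset.mem_range.mpr hi) h

theorem bitSum_sumMask (l : List ℕ) (hl : ∀ i ∈ l, i < n) :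
    bitSum val n (sumMask l) = (l.map val).sum := by
  induction l with
  | nil => exact bitSum_zero val n
  | cons i l ih =>
    rw [sumMask, force_eq, List.map_cons, List.sum_cons,
      ← ih fun j hj => hl j (List.mem_cons_of_mem _ hj),
      ← bitSum_one_shiftLeft val n (hl i List.mem_cons_self), add_comm]
    exact bitSum_xor val n _ _

theorem testBit_maskOf (l : List ℕ) (i : ℕ) : (maskOf l).testBit i = true ↔ i ∈ l := by
  induction l with
  | nil => simp [maskOf]
  | cons j l ih =>
    rw [maskOf, force_eq]
    change (maskOf l ||| 1 <<< j).testBit i = true ↔ _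
    rw [Nat.testBit_or, Bool.or_eq_true, ih, Nat.one_shiftLeft, Nat.testBit_two_pow, List.mem_cons,
      decide_eq_true_iff]
    tauto

theorem eq_of_land_pred_eq_zero {u i j : ℕ} (hu : u &&& (u - 1) = 0) (hi : u.testBit i = true)
    (hj : u.testBit j = true) : i = j := by
  have hu0 : u ≠ 0 := by
    rintro rfl
    simp at hi
  obtain ⟨k, rfl⟩ := (Nat.and_sub_one_eq_zero_iff_isPowerOfTwo hu0).mp hu
  rw [Nat.testBit_two_pow, decide_eq_true_iff] at hi hj
  omega

variable {N val n}

/-- If a sum lies in $N$ and all its summands but one do, so does the last. The test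
$u\wedge(u-1)=0$ says that the mask $u$ of unknown digits has at most one digit. -/
theorem AllIn.learn {known w : ℕ} (hk : AllIn N val n known) (hw : bitSum val n w ∈ N) :
    AllIn N val n (learn known w) := by
  have key : HitProblem.learn known w =
      if (w ^^^ (w &&& known)) &&& ((w ^^^ (w &&& known)) - 1) = 0 then known ||| w else known := by
    rw [HitProblem.learn, force_eq]
    exact casesOn_eq_ite _ _ _
  rw [key]
  split_ifs with hu
  · intro i hi hb
    by_cases hki : known.testBit i = true
    · exact hk i hi hki
    · have hbit : ∀ j, (w ^^^ (w &&& known)).testBit j = (w.testBit j && !known.testBit j) := by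
        intro j
        rw [Nat.testBit_xor, Nat.testBit_and]
        cases w.testBit j <;> cases known.testBit j <;> rfl
      rw [Nat.testBit_or, Bool.or_eq_true] at hb
      have hwi : w.testBit i = true := hb.resolve_left hki
      have hui : (w ^^^ (w &&& known)).testBit i = true := by
        rw [hbit, hwi]
        simpa using hki
      rw [bitSum, ← Finset.add_sum_erase _ _ (Finset.mem_range.mpr hi), if_pos hwi] at hw
      refine (Submodule.add_mem_iff_left _ (sum_mem fun j hj => ?_)).mp hw
      obtain ⟨hji, hjn⟩ := Finset.mem_erase.mp hj
      split_ifs with hwj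
      · refine hk j (Finset.mem_range.mp hjn) ?_
        by_contra hkj
        refine hji (eq_of_land_pred_eq_zero hu ?_ hui)
        rw [hbit, hwj]
        simpa using hkj
      · exact zero_mem _
  · exact hk

theorem AllIn.learnAll {l : List ℕ} {known : ℕ} (hk : AllIn N val n known)
    (hl : ∀ w ∈ l, bitSum val n w ∈ N) : AllIn N val n (learnAll l known) := by
  induction l generalizing known with
  | nil => exact hk
  | cons w l ih =>
    rw [HitProblem.learnAll, force_eq]
    exact ih (hk.learn (hl w List.mem_cons_self)) fun v hv => hl v (List.mem_cons_of_mem _ hv)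

theorem AllIn.learnRepeat {l : List ℕ} {known : ℕ} (m : ℕ) (hk : AllIn N val n known)
    (hl : ∀ w ∈ l, bitSum val n w ∈ N) : AllIn N val n (learnRepeat l m known) := by
  induction m generalizing known with
  | zero => exact hk
  | succ m ih =>
    rw [HitProblem.learnRepeat, force_eq]
    exact ih (hk.learnAll hl)

theorem bitSum_reduceMask_mem {l : List (ℕ × ℕ)} {w : ℕ} (hl : ∀ p ∈ l, bitSum val n p.2 ∈ N)
    (hw : bitSum val n w ∈ N) : bitSum val n (reduceMask l w) ∈ N := by
  induction l with
  | nil => exact hw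
  | cons p l ih =>
    have h1 := ih fun q hq => hl q (List.mem_cons_of_mem _ hq)
    have e : reduceMask (p :: l) w =
        reduceMask l w ^^^ (p.2 * ((reduceMask l w >>> p.1) % 2)) :=
      force_eq (reduceMask l w) fun v =>
        Nat.xor v (Nat.mul p.2 (Nat.mod (Nat.shiftRight v p.1) 2))
    rw [e, bitSum_xor]
    refine add_mem h1 ?_
    rcases Nat.mod_two_eq_zero_or_one (reduceMask l w >>> p.1) with h | h <;> rw [h]
    · rw [mul_zero, bitSum_zero]
      exact zero_mem _
    · rw [mul_one]
      exact hl p List.mem_cons_self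

/-- Every row remains a sum of given relations whatever pivots are stored, so the choice of pivots
needs no proof of correctness. -/
theorem bitSum_eliminate_mem {ws : List ℕ} {acc : List (ℕ × ℕ)}
    (hw : ∀ w ∈ ws, bitSum val n w ∈ N) (hacc : ∀ p ∈ acc, bitSum val n p.2 ∈ N) :
    ∀ p ∈ eliminate ws acc, bitSum val n p.2 ∈ N := by
  induction ws generalizing acc with
  | nil => exact hacc
  | cons w ws ih =>
    rw [eliminate, force_eq, force_eq, force_eq]
    refine ih (fun v hv => hw v (List.mem_cons_of_mem _ hv)) fun p hp => ?_
    rcases List.mem_cons.mp hp with rfl | hp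
    · exact bitSum_reduceMask_mem hacc (hw w List.mem_cons_self)
    · exact hacc p hp

end Masks

theorem testBit_filterMask (p : ℕ → Bool) (l : List ℕ) (i : ℕ) :
    (filterMask p l).testBit i = (l[i]?).any p := by
  induction l generalizing i with
  | nil => simp [filterMask]
  | cons t l ih =>
    rw [filterMask, force_eq]
    have hlt := Bool.toNat_lt (p t)
    cases i with
    | zero =>
      rw [Nat.testBit_zero]
      cases h : p t <;> simp [h]
    | succ i =>
      rw [Nat.testBit_succ, show (2 * filterMask p l + (p t).toNat) / 2 = filterMask p l by omega,
        ih]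
      simp

theorem testBit_unionMask (sel : ℕ → Bool) (masks l : List ℕ) (i : ℕ) :
    (unionMask sel masks l).testBit i = l.any fun o => sel o && (masks.getD o 0).testBit i := by
  induction l with
  | nil => simp [unionMask]
  | cons o l ih =>
    rw [unionMask, force_eq, List.any_cons, ← ih]
    cases sel o with
    | false => simp
    | true =>
      change (unionMask sel masks l ||| masks.getD o 0).testBit i = _
      rw [Nat.testBit_or, Bool.true_and, Bool.or_comm]

/-- Position $i$ belongs to exactly one level set of $f$, so the union over selected values tests
whether the value of $f$ there is selected. -/
theorem testBit_unionMask_levelMasks {n : ℕ} (sel : ℕ → Bool) (f : ℕ → ℕ) (l : List ℕ) {i : ℕ}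
    (hi : i < l.length) (hf : f l[i] < n) :
    (unionMask sel (levelMasks n f l) (List.range n)).testBit i = sel (f l[i]) := by
  rw [testBit_unionMask, Bool.eq_iff_iff, List.any_eq_true]
  have key : ∀ o < n, ((levelMasks n f l).getD o 0).testBit i = (f l[i] == o) := by
    intro o ho
    rw [levelMasks, List.getD_eq_getElem?_getD, List.getElem?_map, List.getElem?_range ho]
    simp only [Option.map_some, Option.getD_some]
    rw [testBit_filterMask, List.getElem?_eq_getElem hi]
    rfl
  constructor
  · rintro ⟨o, ho, h⟩
    rw [key o (List.mem_range.mp ho), Bool.and_eq_true, beq_iff_eq] at h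
    rw [h.2]
    exact h.1
  · intro h
    exact ⟨f l[i], List.mem_range.mpr hf, by rw [key _ hf, h]; simp⟩

theorem digit_lt (i n : ℕ) : digit i n < 5 := Nat.mod_lt _ (by norm_num)

/-- The value of a functional on the monomial with a given code. -/
def functionalValue (g t : ℕ) : Bool :=
  minor (colsBut g (digit 4 t)) [0, 1, 2, 3] && (minor (colsBut g (digit 3 t)) [0, 1, 2, 3] &&
    (minor [column g (digit 2 t), column g (digit 1 t)] [0, 1] &&
      minor [column g (digit 0 t)] [0]))

theorem testBit_functionalMask (g : ℕ) (l : List ℕ) {i : ℕ} (hi : i < l.length) :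
    (functionalMask (levelMasks 5 (digit 4) l) (levelMasks 5 (digit 3) l)
      (levelMasks 25 (fun t => digit 2 t * 5 + digit 1 t) l) (levelMasks 5 (digit 0) l) g).testBit i
      = functionalValue g l[i] := by
  have h1 := digit_lt 1 l[i]
  have h2 := digit_lt 2 l[i]
  rw [functionalMask]
  change Nat.testBit (_ &&& (_ &&& (_ &&& _))) i = _
  rw [Nat.testBit_and, Nat.testBit_and, Nat.testBit_and,
    testBit_unionMask_levelMasks _ _ _ hi (digit_lt _ _),
    testBit_unionMask_levelMasks _ _ _ hi (digit_lt _ _),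
    testBit_unionMask_levelMasks _ _ _ hi (digit_lt _ _),
    testBit_unionMask_levelMasks _ _ _ hi (by omega), functionalValue,
    show (digit 2 l[i] * 5 + digit 1 l[i]) / 5 = digit 2 l[i] by omega,
    show (digit 2 l[i] * 5 + digit 1 l[i]) % 5 = digit 1 l[i] by omega]

/-! ### Monomials from lists of exponents -/

/-- The monomial with the listed exponents. -/
noncomputable def listExp (k : ℕ) (l : List ℕ) : Mon k :=
  Finsupp.equivFunOnFinite.symm fun j => l.getD j 0

theorem listExp_apply {k : ℕ} (l : List ℕ) (j : Fin k) : listExp k l j = l.getD j 0 := rfl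

theorem listExp_injective {k : ℕ} {l m : List ℕ} (hl : l.length = k) (hm : m.length = k)
    (h : listExp k l = listExp k m) : l = m := by
  refine List.ext_getElem (hl.trans hm.symm) fun i h1 h2 => ?_
  have := DFunLike.congr_fun h ⟨i, hl ▸ h1⟩
  simpa [listExp_apply, h1, h2] using this

theorem weight_listExp {k : ℕ} {l : List ℕ} (hl : l.length = k) (i : ℕ) :
    weight (listExp k l) i = (l.map (alpha i)).sum := by
  subst hl
  rw [weight_apply]
  simp only [listExp_apply]
  rw [← List.sum_ofFn]
  congr 1
  refine List.ext_getElem (by simp) fun j h1 h2 => ?_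
  simp

theorem weight_listExp_of_hasWeight {k : ℕ} {l : List ℕ} (hl : l.length = k)
    (h : hasWeight l = true) : weight (listExp k l) = omegaBar 5 3 := by
  simp only [hasWeight, Bool.and_eq_true, List.all_eq_true, decide_eq_true_iff, beq_iff_eq] at h
  obtain ⟨⟨⟨⟨hlt, h0⟩, h1⟩, h2⟩, h3⟩ := h
  ext i
  rw [weight_listExp hl, omegaBar_apply]
  split_ifs with e0 e1 e2 e3
  · rw [e0, h0]
  · rw [e1, h1]
  · rw [e2, h2]
  · rw [e3, h3]
  · refine List.sum_eq_zero fun x hx => ?_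
    obtain ⟨a, ha, rfl⟩ := List.mem_map.mp hx
    have : 2 ^ 4 ≤ 2 ^ i := Nat.pow_le_pow_right (by norm_num) (by omega)
    rw [alpha, Nat.div_eq_of_lt (by have := hlt a ha; omega), Nat.zero_mod]

theorem X_eq_prod {k : ℕ} (a : Fin k) :
    (MvPolynomial.X a : P k) = ∏ j : Fin k, MvPolynomial.X j ^ (if (j : ℕ) = a then 1 else 0) := by
  rw [Finset.prod_eq_single a]
  · simp
  · intro j _ hj
    rw [if_neg fun h => hj (Fin.ext h), pow_zero]
  · simp

theorem varProd_allBut_eq_prod (o : Fin 5) :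
    varProd (allBut o) = ∏ j : Fin 5, MvPolynomial.X j ^ (if (j : ℕ) = o then 0 else 1) := by
  rw [varProd, allBut, ← Finset.mul_prod_erase Finset.univ _ (Finset.mem_univ o), if_pos rfl,
    pow_zero, one_mul]
  refine Finset.prod_congr rfl fun j hj => ?_
  rw [if_neg fun h => Finset.ne_of_mem_erase hj (Fin.ext h), pow_one]

/-- The term with a given code. -/
noncomputable def codeTerm (n : ℕ) : P 5 :=
  term (Fin.ofNat 5 (n / 5 ^ 4)) (Fin.ofNat 5 (n / 5 ^ 3)) (Fin.ofNat 5 (n / 5 ^ 2))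
    (Fin.ofNat 5 (n / 5 ^ 1)) (Fin.ofNat 5 (n / 5 ^ 0))

theorem codeExps_length (n : ℕ) : (codeExps n).length = 5 := by simp [codeExps]

theorem toPoly_codeExps (n : ℕ) : toPoly (listExp 5 (codeExps n)) = codeTerm n := by
  rw [codeTerm, term, levels, varProd_allBut_eq_prod, varProd_allBut_eq_prod, X_eq_prod,
    X_eq_prod, X_eq_prod]
  simp only [← Finset.prod_pow, ← Finset.prod_mul_distrib]
  rw [toPoly_eq_prod]
  refine Finset.prod_congr rfl fun j _ => ?_
  simp only [← pow_mul, ← pow_add, listExp_apply]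
  congr 1
  have : (codeExps n).getD j 0 = _ :=
    (List.getD_eq_getElem _ _ (by rw [codeExps_length]; exact j.2)).trans
      (by rw [List.getElem_of_eq (codeExps.eq_1 n), List.getElem_map, List.getElem_range])
  rw [this]
  change _ = (if (j : ℕ) = digit 4 n then 0 else 1) + ((if (j : ℕ) = digit 3 n then 0 else 1)
    + ((if (j : ℕ) = digit 2 n then 1 else 0) + (if (j : ℕ) = digit 1 n then 1 else 0)
      + (if (j : ℕ) = digit 0 n then 1 else 0) * 2) * 2) * 2
  ring

theorem termCode_digits (o₀ o₁ a b d : Fin 5) :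
    codeTerm (termCode o₀ o₁ a b d) = term o₀ o₁ a b d := by
  have key : ∀ a b : Fin 5,
      codeTerm (o₀ * 625 + o₁ * 125 + a * 25 + b * 5 + d) = term o₀ o₁ a b d := by
    intro a b
    rw [codeTerm]
    congr 1 <;> ext <;> simp only [Fin.val_ofNat] <;> omega
  rw [termCode]
  split_ifs
  · exact key a b
  · rw [key b a, term_swap]

theorem termCode_lt (o₀ o₁ a b d : Fin 5) : termCode o₀ o₁ a b d < 3125 := by
  rw [termCode]
  split_ifs <;> omega

end HitProblem

/-! ### The classes of $S$ span, and they are independent. -/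

namespace HitProblem

/-! ### Spanning -/

/-- The span of the basis monomials. -/
noncomputable def basisSpan : Submodule (ZMod 2) (P 5) :=
  Submodule.span (ZMod 2) {f | ∃ n ∈ basisCodes, f = codeTerm n}

theorem plusProj_add_mem {f : P 5} (hf : f ∈ hit 5) : plusProj 5 f ∈ hit 5 ⊔ basisSpan :=
  Submodule.mem_sup_left (plusProj_mem_hit hf)

theorem sum_map_range_five {M : Type*} [AddCommMonoid M] (f : ℕ → M) :
    ((List.range 5).map f).sum = ∑ j : Fin 5, f j := by
  simp [List.range_succ, Fin.sum_univ_five, add_assoc]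

theorem relations_valid : ∀ r ∈ relations, (∀ i ∈ r, i < 3125) ∧
    (r.map fun n => plusProj 5 (codeTerm n)).sum ∈ hit 5 ⊔ basisSpan := by
  have hf : ∀ {n : ℕ} (h : n < 5), ∃ m : Fin 5, n = m := fun h => ⟨⟨_, h⟩, rfl⟩
  intro r hr
  simp only [relations, List.mem_append, List.mem_flatMap, List.mem_map, List.mem_range] at hr
  rcases hr with ((⟨o₀, h₀, o₁, h₁, b, hb, a, ha, d, hd, rfl⟩ |
    ⟨o₀, h₀, o₁, h₁, c, hc, b, hb, a, ha, rfl⟩) | ⟨o, ho, f, hf', d, hd, rfl⟩) |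
    ⟨f, hf', d, hd, rfl⟩
  · obtain ⟨a, rfl⟩ := hf (ha.trans hb)
    obtain ⟨o₁, rfl⟩ := hf (h₁.trans h₀)
    obtain ⟨o₀, rfl⟩ := hf h₀
    obtain ⟨b, rfl⟩ := hf hb
    obtain ⟨d, rfl⟩ := hf hd
    constructor
    · simp [termCode_lt]
    · simp only [List.map_cons, List.map_nil, List.sum_cons, List.sum_nil, add_zero,
        termCode_digits, ← map_add]
      exact plusProj_add_mem (term_add_term_mem_hit (Fin.ne_of_gt h₁) a b d)
  · obtain ⟨a, rfl⟩ := hf (ha.trans (hb.trans hc))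
    obtain ⟨b, rfl⟩ := hf (hb.trans hc)
    obtain ⟨c, rfl⟩ := hf hc
    obtain ⟨o₀, rfl⟩ := hf h₀
    obtain ⟨o₁, rfl⟩ := hf h₁
    constructor
    · simp [termCode_lt]
    · simp only [List.map_cons, List.map_nil, List.sum_cons, List.sum_nil, add_zero,
        termCode_digits, ← map_add, ← add_assoc]
      exact plusProj_add_mem (term_triple_mem_hit o₀ o₁ a b c)
  · obtain ⟨o, rfl⟩ := hf ho
    obtain ⟨f, rfl⟩ := hf hf'
    obtain ⟨d, rfl⟩ := hf hd
    constructor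
    · intro i hi
      obtain ⟨j, hj, rfl⟩ := List.mem_map.mp hi
      obtain ⟨j, rfl⟩ := hf (List.mem_range.mp hj)
      exact termCode_lt _ _ _ _ _
    · rw [List.map_map, sum_map_range_five]
      simp only [Function.comp_apply, termCode_digits, ← map_sum]
      exact plusProj_add_mem (sum_term_middle_mem_hit o f d)
  · obtain ⟨f, rfl⟩ := hf hf'
    obtain ⟨d, rfl⟩ := hf hd
    constructor
    · intro i hi
      obtain ⟨j, hj, rfl⟩ := List.mem_map.mp hi
      obtain ⟨j, rfl⟩ := hf (List.mem_range.mp hj)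
      exact termCode_lt _ _ _ _ _
    · rw [List.map_map, sum_map_range_five]
      simp only [Function.comp_apply, termCode_digits, ← map_sum]
      exact plusProj_add_mem (sum_term_bottom_mem_hit f d)

theorem codeTerm_mem_hit_of_digit_eq {n : ℕ} (h : digit 2 n = digit 1 n) : codeTerm n ∈ hit 5 := by
  have : Fin.ofNat 5 (n / 5 ^ 2) = Fin.ofNat 5 (n / 5 ^ 1) := Fin.ext h
  rw [codeTerm, this]
  exact term_self_mem_hit _ _ _ _

theorem plusProj_codeTerm_of_mem {n : ℕ} (h : 0 ∈ codeExps n) : plusProj 5 (codeTerm n) = 0 := by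
  rw [← toPoly_codeExps, plusProj_toPoly, if_neg]
  intro hpos
  obtain ⟨i, hi, h0⟩ := List.mem_iff_getElem.mp h
  have := hpos ⟨i, codeExps_length n ▸ hi⟩
  rw [listExp_apply, List.getD_eq_getElem _ _ hi] at this
  omega

theorem codeExps_pos {n : ℕ} (hn : n ∈ basisCodes) (j : Fin 5) : 0 < listExp 5 (codeExps n) j := by
  have h := basisCodes_check.2 n hn
  rw [Bool.and_eq_true, List.all_eq_true] at h
  have hj : (j : ℕ) < (codeExps n).length := by rw [codeExps_length]; exact j.2
  rw [listExp_apply, List.getD_eq_getElem _ _ hj]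
  exact of_decide_eq_true (h.2 _ (List.getElem_mem hj))

theorem weight_codeExps {n : ℕ} (hn : n ∈ basisCodes) :
    weight (listExp 5 (codeExps n)) = omegaBar 5 3 := by
  have h := basisCodes_check.2 n hn
  rw [Bool.and_eq_true] at h
  exact weight_listExp_of_hasWeight (codeExps_length n) h.1

theorem plusProj_codeTerm {n : ℕ} (hn : n ∈ basisCodes) :
    plusProj 5 (codeTerm n) = codeTerm n := by
  rw [← toPoly_codeExps, plusProj_toPoly, if_pos (codeExps_pos hn)]

/-- Up to hit polynomials, the positive monomials of weight `(4, 4, 2, 1)` are in the span of the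
basis monomials. -/
theorem plusProj_term_mem (o₀ o₁ a b d : Fin 5) :
    plusProj 5 (term o₀ o₁ a b d) ∈ hit 5 ⊔ basisSpan := by
  -- Known from the start are the basis monomials, the hit terms with equal third-level entries, and
  -- the monomials lacking a variable, which the projection kills.
  have hstart : AllIn (hit 5 ⊔ basisSpan) (fun n => plusProj 5 (codeTerm n)) 3125
      (maskOf startCodes) := by
    intro i _ hi
    rw [testBit_maskOf, startCodes, List.mem_append, List.mem_filter, decide_eq_true_iff] at hi
    beta_reduce
    rcases hi with hi | ⟨-, hi | hi⟩
    · rw [plusProj_codeTerm hi]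
      exact Submodule.mem_sup_right (Submodule.subset_span ⟨i, hi, rfl⟩)
    · exact plusProj_add_mem (codeTerm_mem_hit_of_digit_eq hi)
    · rw [plusProj_codeTerm_of_mem hi]
      exact zero_mem _
  have hall := hstart.learnRepeat (l := relations.map sumMask) 8 fun w hw => by
    obtain ⟨r, hr, rfl⟩ := List.mem_map.mp hw
    rw [bitSum_sumMask _ _ _ (relations_valid r hr).1]
    exact (relations_valid r hr).2
  have hc := List.all_eq_true.mp spanning_check (termCode o₀ o₁ a b d) (by
    simp only [allCodes, List.mem_flatMap, List.mem_map, List.mem_range]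
    exact ⟨o₀, o₀.2, o₁, o₁.2, a, a.2, b, b.2, d, d.2, rfl⟩)
  have := hall _ (termCode_lt o₀ o₁ a b d) hc
  beta_reduce at this
  rwa [termCode_digits] at this

/-! ### Independence -/

theorem allBut_eq_toFinset (o : Fin 5) :
    allBut o = ((List.finRange 5).filter (· ≠ o)).toFinset := by
  revert o; decide

theorem colsBut_eq (g : ℕ) (o : Fin 5) :
    ((List.finRange 5).filter (· ≠ o)).map (fun j : Fin 5 => column g j) = colsBut g o := by
  have : ((List.finRange 5).filter (· ≠ o)).map (fun j : Fin 5 => (j : ℕ)) =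
      (List.range 5).filter (· ≠ (o : ℕ)) := by
    revert o; decide
  rw [colsBut, ← this, List.map_map]
  rfl

theorem spikeFun_codeTerm (g n : ℕ) :
    spikeFun (fun j : Fin 5 => column g j) (codeTerm n) = bitVal (functionalValue g n) := by
  have hn : ∀ o : Fin 5, ((List.finRange 5).filter (· ≠ o)).Nodup :=
    fun o => (List.nodup_finRange 5).filter _
  have hc : ∀ o : Fin 5, ((List.finRange 5).filter (· ≠ o)).length = 4 := by decide
  rw [codeTerm, term, allBut_eq_toFinset, allBut_eq_toFinset,
    spikeFun_levels _ (hn _) (hn _) (hc _) (hc _), colsBut_eq, colsBut_eq]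
  rfl

/-- The classes of the basis monomials are linearly independent. -/
theorem linearIndependent_basisCodes :
    LinearIndependent (ZMod 2) fun i : Fin basisCodes.length =>
      (hit 5).mkQ (codeTerm basisCodes[i]) := by
  rw [Fintype.linearIndependent_iff]
  intro c hc
  have hlen := basisCodes_check.1
  have hhit : ∑ i, c i • codeTerm basisCodes[i] ∈ hit 5 := by
    rw [← Submodule.Quotient.mk_eq_zero, ← Submodule.mkQ_apply, map_sum]
    simpa only [map_smul] using hc
  -- The coefficients of a supposed dependence, shifted past the twenty tag digits, where `v` is
  -- zero. Each functional yields a linear equation for them; propagation in the zero submodule then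
  -- proves that coefficients vanish.
  set v : ℕ → ZMod 2 := fun n =>
    if h : 20 ≤ n ∧ n - 20 < basisCodes.length then c ⟨n - 20, h.2⟩ else 0 with hv
  have hmask : ∀ w ∈ functionalMasks basisCodes,
      bitSum v 375 w ∈ (⊥ : Submodule (ZMod 2) (ZMod 2)) := by
    intro w hw
    simp only [functionalMasks, forceList_eq, List.mem_map] at hw
    obtain ⟨g, hg, rfl⟩ := hw
    have hg20 : g < 2 ^ 20 := by
      have : ∀ g ∈ functionals, g < 2 ^ 20 := by decide +kernel
      exact this g hg
    rw [Submodule.mem_bot]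
    have h0 := spikeFun_eq_zero (fun j : Fin 5 => column g j) hhit
    rw [map_sum] at h0
    rw [← h0, bitSum, show 375 = 20 + 355 from rfl, Finset.sum_range_add, Finset.sum_eq_zero,
      zero_add, ← hlen, ← Fin.sum_univ_eq_sum_range (fun i => if Nat.testBit _ (20 + i) = true
        then v (20 + i) else 0)]
    · refine Finset.sum_congr rfl fun i _ => ?_
      rw [map_smul, spikeFun_codeTerm]
      have e1 : v (20 + i) = c i := by
        rw [hv]
        simp
      generalize hF : functionalMask _ _ _ _ g = F
      have e2 : Nat.testBit (Nat.add (Nat.mul F (2 ^ 20)) g) (20 + i)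
          = functionalValue g basisCodes[i] := by
        change Nat.testBit (F * 2 ^ 20 + g) (20 + i) = _
        rw [mul_comm, Nat.testBit_two_pow_mul_add _ hg20, if_neg (by omega),
          Nat.add_sub_cancel_left, ← hF, testBit_functionalMask g basisCodes i.2]
        rfl
      rw [e1, e2]
      cases functionalValue g basisCodes[i] <;> simp [bitVal]
    · intro i hi
      have : v i = 0 := by
        rw [hv]
        have := Finset.mem_range.mp hi
        exact dif_neg (by omega)
      rw [this, ite_self]
  have helim := bitSum_eliminate_mem hmask (acc := []) (by simp)
  have hstart : AllIn (⊥ : Submodule (ZMod 2) (ZMod 2)) v 375 (2 ^ 20 - 1) := by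
    intro i _ hi
    rw [Nat.testBit_two_pow_sub_one, decide_eq_true_iff] at hi
    rw [Submodule.mem_bot, hv]
    exact dif_neg (by omega)
  have hall := hstart.learnAll (l := (eliminate (functionalMasks basisCodes) []).map Prod.snd)
    fun w hw => by
      obtain ⟨p, hp, rfl⟩ := List.mem_map.mp hw
      exact helim p hp
  have hcheck := independence_check
  rw [forceList_eq] at hcheck
  rw [hcheck] at hall
  intro i
  have hi : (i : ℕ) < 355 := hlen ▸ i.2
  have := hall (20 + i) (by omega) (by
    rw [Nat.testBit_two_pow_sub_one, decide_eq_true_iff]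
    omega)
  rw [Submodule.mem_bot, hv] at this
  simpa using this

end HitProblem

/-! ### Determination of $B_4(\bar\omega)$. -/

namespace HitProblem

/-! ### The admissible monomials in four variables -/

/-- Functionals that are nonzero on the given admissible monomial and vanish on all smaller
monomials, as sums of functionals given by matrices. -/
def fourFunctionals : List ((ℕ × ℕ × ℕ) × List ℕ) :=
  [((0, 1, 0), [33825]), ((0, 1, 1), [33810]), ((0, 1, 2), [33090, 33106]),
    ((0, 1, 3), [6210, 6226]), ((0, 2, 0), [33345]), ((0, 2, 1), [33300, 33301]),
    ((0, 2, 2), [33090]), ((0, 2, 3), [6210, 6466]), ((0, 3, 0), [10305]),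
    ((0, 3, 1), [10260, 10261]), ((0, 3, 2), [8580, 8581]), ((0, 3, 3), [6210]),
    ((1, 2, 1), [33300]), ((1, 2, 2), [33060]), ((1, 2, 3), [6180, 6436]), ((1, 3, 1), [10260]),
    ((1, 3, 2), [8580, 8596]), ((1, 3, 3), [6180]), ((2, 3, 2), [8580]), ((2, 3, 3), [4740])]

/-- The value of a functional on a monomial in four variables. -/
def fourValue (t : ℕ × ℕ × ℕ) (g : ℕ) : Bool :=
  minor ((List.range 4).map (column g)) [0, 1, 2, 3] &&
    (minor ((List.range 4).map (column g)) [0, 1, 2, 3] &&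
    (minor [column g t.1, column g t.2.1] [0, 1] && minor [column g t.2.2] [0]))

def fourSum (gs : List ℕ) (t : ℕ × ℕ × ℕ) : Bool :=
  gs.foldr (fun g b => xor (fourValue t g) b) false

/-- The left lexicographical order on exponents. -/
def LexLT (l m : List ℕ) : Prop :=
  ∃ j : Fin 4, (∀ i : Fin 4, i < j → l.getD i 0 = m.getD i 0) ∧ l.getD j 0 < m.getD j 0

instance (l m : List ℕ) : Decidable (LexLT l m) := by
  unfold LexLT
  infer_instance

theorem fourFunctionals_complete : ∀ t ∈ topLevels, t.1 ≤ t.2.2 →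
    ∃ p ∈ fourFunctionals, p.1 = t := by
  decide +kernel

theorem fourFunctionals_check : ∀ p ∈ fourFunctionals, fourSum p.2 p.1 = true ∧
    ∀ s ∈ topLevels, LexLT (topExps s) (topExps p.1) → fourSum p.2 s = false := by
  decide +kernel

theorem topLevels_check : ∀ t ∈ topLevels, hasWeight (topExps t) = true ∧
    ∑ j : Fin 4, (topExps t).getD j 0 = 28 := by
  decide +kernel

theorem topExps_triple_check : ∀ x y d : Fin 4, d < x → x < y →
    LexLT (topExps (d, y, x)) (topExps (x, y, d)) ∧
    LexLT (topExps (d, x, y)) (topExps (x, y, d)) ∧ topExps (d, y, x) ≠ topExps (d, x, y) := by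
  decide +kernel

theorem topExps_length (t : ℕ × ℕ × ℕ) : (topExps t).length = 4 := by simp [topExps]

theorem mem_topLevels {x y d : Fin 4} (h : x < y) : ((x : ℕ), (y : ℕ), (d : ℕ)) ∈ topLevels := by
  simp only [topLevels, List.mem_flatMap, List.mem_map, List.mem_range]
  exact ⟨y, y.2, x, h, d, d.2, rfl⟩

theorem toPoly_topExps (a b d : Fin 4) :
    toPoly (listExp 4 (topExps (a, b, d))) = levels Finset.univ Finset.univ a b d := by
  rw [levels, X_eq_prod, X_eq_prod, X_eq_prod, varProd]
  simp only [← Finset.prod_pow, ← Finset.prod_mul_distrib]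
  rw [toPoly_eq_prod]
  refine Finset.prod_congr rfl fun j _ => ?_
  rw [← pow_mul, ← pow_add, ← pow_add, ← pow_mul, ← pow_succ', ← pow_mul, ← pow_succ']
  congr 1
  rw [listExp_apply, List.getD_eq_getElem _ _ (by rw [topExps_length]; exact j.2)]
  simp only [topExps, List.getElem_map, List.getElem_range]
  ring

theorem toPoly_injective {k : ℕ} : Function.Injective (toPoly : Mon k → P k) :=
  MvPolynomial.monomial_left_injective one_ne_zero

theorem exists_topLevels {a : Mon 4} (ha : weight a = omegaBar 5 3) :
    ∃ x y d : Fin 4, x < y ∧ a = listExp 4 (topExps (x, y, d)) := by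
  obtain ⟨J₀, J₁, x, y, d, h₀, h₁, hxy, h⟩ := exists_levels ha
  obtain rfl := (Finset.card_eq_iff_eq_univ J₀).mp h₀
  obtain rfl := (Finset.card_eq_iff_eq_univ J₁).mp h₁
  exact ⟨x, y, d, hxy, toPoly_injective (h.trans (toPoly_topExps x y d).symm)⟩

theorem spikeFun_topExps (g : ℕ) (a b d : Fin 4) :
    spikeFun (fun j : Fin 4 => column g j) (toPoly (listExp 4 (topExps (a, b, d)))) =
      bitVal (fourValue (a, b, d) g) := by
  have hu : (Finset.univ : Finset (Fin 4)) = (List.finRange 4).toFinset := by decide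
  rw [toPoly_topExps, hu, spikeFun_levels _ (List.nodup_finRange 4) (List.nodup_finRange 4)
    (by simp) (by simp)]
  rfl

/-- A sum of functionals given by matrices. -/
noncomputable def sumFun (gs : List ℕ) : P 4 →ₗ[ZMod 2] ZMod 2 :=
  (gs.map fun g => spikeFun fun j : Fin 4 => column g j).sum

theorem sumFun_apply (gs : List ℕ) (f : P 4) :
    sumFun gs f = (gs.map fun g => spikeFun (fun j : Fin 4 => column g j) f).sum := by
  induction gs with
  | nil => rfl
  | cons g gs ih =>
    rw [sumFun, List.map_cons, List.sum_cons, LinearMap.add_apply, ← sumFun, ih, List.map_cons,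
      List.sum_cons]

theorem sumFun_eq_zero (gs : List ℕ) {f : P 4} (hf : f ∈ hit 4) : sumFun gs f = 0 := by
  rw [sumFun_apply]
  refine List.sum_eq_zero fun x hx => ?_
  obtain ⟨g, -, rfl⟩ := List.mem_map.mp hx
  exact spikeFun_eq_zero _ hf

theorem sumFun_topExps (gs : List ℕ) (a b d : Fin 4) :
    sumFun gs (toPoly (listExp 4 (topExps (a, b, d)))) = bitVal (fourSum gs (a, b, d)) := by
  rw [sumFun_apply, fourSum, bitVal_foldr_xor]
  simp only [spikeFun_topExps]

theorem degree_listExp_topExps {t : ℕ × ℕ × ℕ} (ht : t ∈ topLevels) :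
    (listExp 4 (topExps t)).degree = 28 := by
  rw [Finsupp.degree_eq_sum]
  exact (topLevels_check t ht).2

theorem weight_listExp_topExps {t : ℕ × ℕ × ℕ} (ht : t ∈ topLevels) :
    weight (listExp 4 (topExps t)) = omegaBar 5 3 :=
  weight_listExp_of_hasWeight (topExps_length t) (topLevels_check t ht).1

theorem lt_iff_lexLT (l m : List ℕ) : toLex (listExp 4 l) < toLex (listExp 4 m) ↔ LexLT l m := by
  rw [Finsupp.Lex.lt_iff]
  rfl

/-- A functional that is 1 on the monomial kills hit polynomials, all monomials of smaller weight
(they are hit) and all smaller ones of the same weight; so it contradicts any reduction. -/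
theorem admissible_topExps {x y d : Fin 4} (hxy : x < y) (hd : x ≤ d) :
    Admissible (listExp 4 (topExps (x, y, d))) := by
  rintro ⟨Y, hY, hhit⟩
  have ht := mem_topLevels (d := d) hxy
  obtain ⟨p, hp, hpt⟩ := fourFunctionals_complete _ ht hd
  obtain ⟨h1, h0⟩ := fourFunctionals_check p hp
  rw [hpt] at h1 h0
  have hz := sumFun_eq_zero p.2 hhit
  rw [map_sub, map_sum, sumFun_topExps, h1, Finset.sum_eq_zero, sub_zero] at hz
  · exact absurd hz (by decide)
  · intro b hb
    obtain ⟨hdeg, hlt⟩ := hY b hb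
    rw [degree_listExp_topExps ht] at hdeg
    rw [monLT, weight_listExp_topExps ht] at hlt
    rcases hlt with hlt | ⟨hw, hlt⟩
    · exact sumFun_eq_zero _ (toPoly_mem_hit_of_weight_lt hdeg hlt)
    · obtain ⟨x', y', d', hxy', rfl⟩ := exists_topLevels hw
      rw [lt_iff_lexLT] at hlt
      rw [sumFun_topExps, h0 _ (mem_topLevels hxy') hlt]
      rfl

theorem inadmissible_topExps {x y d : Fin 4} (hxy : x < y) (hd : d < x) :
    Inadmissible (listExp 4 (topExps (x, y, d))) := by
  obtain ⟨hl1, hl2, hne⟩ := topExps_triple_check x y d hd hxy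
  have m0 := mem_topLevels (d := d) hxy
  have m1 := mem_topLevels (d := x) (hd.trans hxy)
  have m2 := mem_topLevels (d := y) hd
  refine ⟨{listExp 4 (topExps (d, y, x)), listExp 4 (topExps (d, x, y))}, ?_, ?_⟩
  · intro b hb
    rw [Finset.mem_insert, Finset.mem_singleton] at hb
    rcases hb with rfl | rfl
    · exact ⟨(degree_listExp_topExps m1).trans (degree_listExp_topExps m0).symm,
        Or.inr ⟨(weight_listExp_topExps m1).trans (weight_listExp_topExps m0).symm,
          (lt_iff_lexLT _ _).mpr hl1⟩⟩
    · exact ⟨(degree_listExp_topExps m2).trans (degree_listExp_topExps m0).symm,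
        Or.inr ⟨(weight_listExp_topExps m2).trans (weight_listExp_topExps m0).symm,
          (lt_iff_lexLT _ _).mpr hl2⟩⟩
  · rw [Finset.sum_pair fun h => hne (listExp_injective (topExps_length _) (topExps_length _) h),
      toPoly_topExps, toPoly_topExps, toPoly_topExps, CharTwo.sub_eq_add, ← add_assoc]
    exact levels_triple_mem_hit (by simp) (by simp) d x y

theorem inadmissible_of_mem_hit {k : ℕ} {a : Mon k} (h : toPoly a ∈ hit k) : Inadmissible a :=
  ⟨∅, by simp, by simpa using h⟩

theorem B_four : B 4 (omegaBar 5 3) = {a | ∃ l ∈ basisFour, a = listExp 4 l} := by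
  ext a
  simp only [B, monLE, Set.mem_ofPred_eq, basisFour, List.mem_map, List.mem_filter,
    decide_eq_true_iff, weightDegree_omegaBar]
  constructor
  · rintro ⟨⟨hdeg, hle⟩, hadm⟩
    have hw : weight a = omegaBar 5 3 := by
      -- A monomial of smaller weight is hit, hence inadmissible with no summands at all; only the
      -- exact weight remains.
      rcases hle.lt_or_eq with hlt | heq
      · exact absurd (inadmissible_of_mem_hit (toPoly_mem_hit_of_weight_lt hdeg hlt)) hadm
      · exact toLex.injective heq
    obtain ⟨x, y, d, hxy, rfl⟩ := exists_topLevels hw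
    refine ⟨_, ⟨_, ⟨mem_topLevels (d := d) hxy, ?_⟩, rfl⟩, rfl⟩
    by_contra hd
    exact hadm (inadmissible_topExps hxy (not_le.mp hd))
  · rintro ⟨_, ⟨⟨x, y, d⟩, ⟨ht, hd⟩, rfl⟩, rfl⟩
    refine ⟨⟨degree_listExp_topExps ht, (weight_listExp_topExps ht).symm ▸ le_rfl⟩, ?_⟩
    simp only [topLevels, List.mem_flatMap, List.mem_map, List.mem_range, Prod.mk.injEq] at ht
    obtain ⟨y', hy, x', hx, d', hd', rfl, rfl, rfl⟩ := ht
    exact admissible_topExps (x := ⟨x', hx.trans hy⟩) (y := ⟨y', hy⟩) (d := ⟨d', hd'⟩) hx hd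

end HitProblem

/-! ### Enumeration of $\Phi^+(B_4(\bar\omega))$ and of $S$. -/

namespace HitProblem

/-! ### The set `Φ⁺(B)` -/

theorem sum_map_filter_range {r : ℕ} (p : ℕ → Bool) (f : ℕ → ℕ) :
    (((List.range r).filter p).map f).sum = ∑ t : Fin r, if p t then f t else 0 := by
  induction r with
  | zero => rfl
  | succ r ih =>
    rw [List.range_succ, List.filter_append, List.map_append, List.sum_append, ih,
      Fin.sum_univ_castSucc]
    congr 1
    cases h : p r <;> simp [h]

/-- The list of indices of the entries of `I`. -/
def indexList (N : NIndex 5) : List ℕ := List.ofFn fun t => (N.I t : ℕ)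

theorem indexList_length (N : NIndex 5) : (indexList N).length = N.r := by simp [indexList]

theorem indexList_getD (N : NIndex 5) (t : Fin N.r) : (indexList N).getD t 0 = N.I t := by
  rw [indexList, List.getD_eq_getElem _ _ (by simp), List.getElem_ofFn]

theorem nuPred_listExp (N : NIndex 5) (l : List ℕ) (t : Fin N.r) :
    nuPred N (listExp 4 l) t = l.getD ((indexList N).getD t 0 - 1) 0 := by
  rw [nuPred, listExp_apply, indexList_getD, Fin.val_pred]

theorem compatible_iff (N : NIndex 5) (l : List ℕ) (u : Fin N.r) :
    Compatible N (listExp 4 l) u ↔ compatList (indexList N) l u = true := by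
  have key : compatList (indexList N) l u = true ↔ ∀ t : Fin N.r,
      (((t : ℕ) < u → nuPred N (listExp 4 l) t = 2 ^ N.r - 1) ∧
        ((u : ℕ) < t → alpha (N.r - 1 - t) (nuPred N (listExp 4 l) t) = 1) ∧
        ((t : ℕ) ≤ u → alpha (N.r - 1 - t) (nuPred N (listExp 4 l) u) = 1)) ∧
        2 ^ N.r - 1 < nuPred N (listExp 4 l) u := by
    simp only [compatList, List.all_eq_true, List.mem_range, indexList_length, Bool.and_eq_true,
      Bool.or_eq_true, Bool.not_eq_true', decide_eq_false_iff_not, beq_iff_eq,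
      decide_eq_true_iff, nuPred_listExp, Fin.forall_iff]
    refine forall₂_congr fun t ht => ?_
    tauto
  rw [key]
  constructor
  · rintro ⟨h1, h2, h3, h4⟩ t
    exact ⟨⟨fun h => h1 t h, fun h => h4 t h, fun h => h3 t h⟩, h2⟩
  · intro h
    exact ⟨fun t ht => (h t).1.1 ht, (h u).2, fun t ht => (h t).1.2.2 ht,
      fun t ht => (h t).1.2.1 ht⟩

/-- The entry at the smaller index would have to be equal to $2^r-1$ and also exceed it. Thus the
choice made in `phi` is the index found by a search. -/
theorem Compatible.unique {n : ℕ} {N : NIndex (n + 1)} {x : Mon n} {u v : Fin N.r}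
    (hu : Compatible N x u) (hv : Compatible N x v) : u = v := by
  rcases lt_trichotomy u v with h | h | h
  · exact absurd (hv.1 u h) hu.2.1.ne'
  · exact h
  · exact absurd (hu.1 v h) hv.2.1.ne'

theorem fMon_apply (i j : Fin 5) (l : List ℕ) :
    fMon i (listExp 4 l) j =
      if (j : ℕ) < i then l.getD j 0 else if (j : ℕ) = i then 0 else l.getD (j - 1) 0 := by
  by_cases hji : j = i
  · subst hji
    rw [if_neg (lt_irrefl _), if_pos rfl, fMon, Finsupp.mapDomain_of_notMem_range]
    rintro ⟨m, hm⟩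
    exact Fin.succAbove_ne _ _ hm
  · obtain ⟨m, rfl⟩ := Fin.exists_succAbove_eq hji
    rw [fMon, Finsupp.mapDomain_apply Fin.succAbove_right_injective, listExp_apply]
    rcases lt_or_ge m.castSucc i with h | h
    · have e : ((i.succAbove m : Fin 5) : ℕ) = m := by rw [Fin.succAbove_of_castSucc_lt _ _ h]; rfl
      have h' : (m : ℕ) < i := h
      rw [e, if_pos h']
    · have e : ((i.succAbove m : Fin 5) : ℕ) = m + 1 := by
        rw [Fin.succAbove_of_le_castSucc _ _ h]; rfl
      have h' : (i : ℕ) ≤ m := h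
      rw [e, if_neg (by omega), if_neg (by omega), Nat.add_sub_cancel]

theorem xIu_apply (N : NIndex 5) (u : Fin N.r) (j : Fin 5) :
    xIu N u j = (if j = N.I u then ∑ t : Fin N.r, if t ≤ u then 2 ^ (N.r - 1 - (t : ℕ)) else 0
        else 0)
      + ∑ t : Fin N.r, if u < t then (if j = N.I t then 2 ^ (N.r - 1 - (t : ℕ)) else 0) else 0 := by
  have h1 : ∀ f : Fin N.r → ℕ, (∑ t, if t ≤ u then f t else 0) = ∑ t ∈ Finset.Iic u, f t := by
    intro f
    rw [← Finset.sum_filter]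
    congr 1
    ext t
    simp
  have h2 : ∀ f : Fin N.r → ℕ, (∑ t, if u < t then f t else 0) = ∑ t ∈ Finset.Ioi u, f t := by
    intro f
    rw [← Finset.sum_filter]
    congr 1
    ext t
    simp
  rw [xIu, Finsupp.add_apply, Finsupp.finsetSum_apply, h1, h2]
  simp only [Finsupp.single_apply, eq_comm (b := j)]

theorem phi_exponents (N : NIndex 5) (l : List ℕ) (u : Fin N.r) :
    Finsupp.single N.i (2 ^ N.r - 1) + fMon N.i (listExp 4 l) - xIu N u =
      listExp 5 (phiExps N.i (indexList N) l u) := by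
  ext j
  rw [Finsupp.tsub_apply, Finsupp.add_apply, fMon_apply, xIu_apply, listExp_apply,
    List.getD_eq_getElem (phiExps N.i (indexList N) l u) _ (by simp [phiExps])]
  simp only [phiExps, List.getElem_map, List.getElem_range, sum_map_filter_range,
    indexList_length, indexList_getD, Finsupp.single_apply, decide_eq_true_iff, Fin.ext_iff,
    Fin.le_def, Fin.lt_def, eq_comm (a := (N.i : ℕ))]

theorem phi_listExp {N : NIndex 5} (hN : 0 < N.r) (l : List ℕ) :
    phi N (listExp 4 l) = (phiList N.i (indexList N) l).map (listExp 5) := by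
  rw [phi, if_neg hN.ne', phiList, Option.map_map]
  split_ifs with h
  · have hu := h.choose_spec
    have : (List.range (indexList N).length).find? (compatList (indexList N) l)
        = some (h.choose : ℕ) := by
      rw [List.find?_range_eq_some]
      refine ⟨(compatible_iff N l _).mp hu, ?_, fun v hv => ?_⟩
      · rw [List.mem_range, indexList_length]
        exact h.choose.2
      · rw [Bool.not_eq_true']
        by_contra hc
        rw [Bool.not_eq_false] at hc
        have hvr : v < N.r := hv.trans h.choose.2
        have := hu.unique ((compatible_iff N l ⟨v, hvr⟩).mpr hc)
        rw [this] at hv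
        exact lt_irrefl _ hv
    rw [this, Option.map_some, Function.comp_apply, phi_exponents]
  · have : (List.range (indexList N).length).find? (compatList (indexList N) l) = none := by
      rw [List.find?_eq_none]
      intro v hv hc
      rw [List.mem_range, indexList_length] at hv
      exact h ⟨⟨v, hv⟩, (compatible_iff N l ⟨v, hv⟩).mpr hc⟩
    rw [this]
    rfl

theorem mem_subs {I l : List ℕ} : I ∈ subs l ↔ I.Sublist l := by
  induction l generalizing I with
  | nil => simp [subs]
  | cons a l ih =>
    rw [subs, List.mem_append, List.mem_map, List.sublist_cons_iff, ih]
    simp only [ih]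
    refine or_congr_right ⟨?_, ?_⟩
    · rintro ⟨J, hJ, rfl⟩
      exact ⟨J, rfl, hJ⟩
    · rintro ⟨J, rfl, hJ⟩
      exact ⟨J, hJ, rfl⟩

theorem mem_indexPairs {i : ℕ} {I : List ℕ} : (i, I) ∈ indexPairs ↔
    i < 5 ∧ I.Pairwise (· < ·) ∧ (∀ t ∈ I, i < t ∧ t < 5) ∧ I ≠ [] := by
  simp only [indexPairs, List.mem_flatMap, List.mem_map, List.mem_filter, List.mem_range, mem_subs,
    decide_eq_true_iff, Prod.mk.injEq]
  have hs : ((List.range 5).filter (i < ·)).Pairwise (· < ·) :=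
    List.Pairwise.filter _ List.pairwise_lt_range
  constructor
  · rintro ⟨i, hi, I, ⟨hI, hne⟩, rfl, rfl⟩
    refine ⟨hi, List.Pairwise.sublist hI (List.Pairwise.filter _ List.pairwise_lt_range),
      fun t ht => ?_, hne⟩
    have := hI.subset ht
    rw [List.mem_filter, List.mem_range, decide_eq_true_iff] at this
    exact this.symm
  · rintro ⟨hi, hp, hm, hne⟩
    refine ⟨i, hi, I, ⟨?_, hne⟩, rfl, rfl⟩
    refine List.sublist_of_subperm_of_pairwise (r := (· < ·)) ?_ hp hs
    refine List.subperm_of_subset (hp.imp fun h => h.ne) fun t ht => ?_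
    rw [List.mem_filter, List.mem_range, decide_eq_true_iff]
    exact (hm t ht).symm

theorem indexPairs_eq : ∀ i I, (i, I) ∈ indexPairs ↔
    ∃ N : NIndex 5, 0 < N.r ∧ i = N.i ∧ I = indexList N := by
  intro i I
  rw [mem_indexPairs]
  constructor
  · rintro ⟨hi, hp, hm, hne⟩
    refine ⟨⟨⟨i, hi⟩, I.length, fun t => ⟨I[t], (hm _ (List.getElem_mem _)).2⟩, ?_, ?_⟩,
      List.length_pos_of_ne_nil hne, rfl, ?_⟩
    · intro s t hst
      exact List.pairwise_iff_getElem.mp hp s t _ _ hst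
    · intro t
      exact (hm _ (List.getElem_mem _)).1
    · exact List.ofFn_getElem.symm
  · rintro ⟨N, hr, rfl, rfl⟩
    refine ⟨N.i.2, ?_, ?_, ?_⟩
    · rw [indexList, List.pairwise_ofFn]
      exact fun s t hst => N.strictMono hst
    · intro t ht
      obtain ⟨s, rfl⟩ := (List.mem_ofFn' _ _).mp ht
      exact ⟨N.lt s, (N.I s).2⟩
    · intro h
      have := indexList_length N
      rw [h] at this
      simp at this
      omega

theorem forall_listExp_pos {l : List ℕ} (hl : l.length = 5) :
    (∀ j, 0 < listExp 5 l j) ↔ l.all (0 < ·) = true := by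
  rw [List.all_eq_true]
  constructor
  · intro h x hx
    obtain ⟨i, hi, rfl⟩ := List.mem_iff_getElem.mp hx
    have := h ⟨i, hl ▸ hi⟩
    rw [listExp_apply, List.getD_eq_getElem _ _ hi] at this
    exact decide_eq_true this
  · intro h j
    have hj : (j : ℕ) < l.length := hl.symm ▸ j.2
    rw [listExp_apply, List.getD_eq_getElem _ _ hj]
    exact of_decide_eq_true (h _ (List.getElem_mem hj))

theorem phiList_length {i : ℕ} {I x l : List ℕ} (h : phiList i I x = some l) : l.length = 5 := by
  rw [phiList, Option.map_eq_some_iff] at h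
  obtain ⟨u, -, rfl⟩ := h
  simp [phiExps]

theorem phiPlus_eq : PhiPlus (B 4 (omegaBar 5 3)) = {a | ∃ l ∈ phiPlusList, a = listExp 5 l} := by
  ext a
  rw [B_four]
  simp only [PhiPlus, Set.mem_ofPred_eq, phiPlusList, List.mem_flatMap, List.mem_filter,
    List.mem_filterMap]
  constructor
  · rintro ⟨⟨N, hN, x, ⟨l, hl, rfl⟩, h⟩, hpos⟩
    rw [phi_listExp hN, Option.map_eq_some_iff] at h
    obtain ⟨m, hm, rfl⟩ := h
    exact ⟨m, ⟨(N.i, indexList N), (indexPairs_eq _ _).mpr ⟨N, hN, rfl, rfl⟩, ⟨l, hl, hm⟩,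
      (forall_listExp_pos (phiList_length hm)).mp hpos⟩, rfl⟩
  · rintro ⟨m, ⟨⟨i, I⟩, hp, ⟨l, hl, hm⟩, hpos⟩, rfl⟩
    obtain ⟨N, hN, rfl, rfl⟩ := (indexPairs_eq _ _).mp hp
    refine ⟨⟨N, hN, _, ⟨l, hl, rfl⟩, ?_⟩, (forall_listExp_pos (phiList_length hm)).mpr hpos⟩
    rw [phi_listExp hN, hm, Option.map_some]

theorem mon5_eq (a b c d e : ℕ) : mon5 a b c d e = listExp 5 [a, b, c, d, e] := by
  ext j
  fin_cases j <;> rfl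

theorem extraC_eq : extraC = {a | ∃ l ∈ extraList, a = listExp 5 l} := by
  ext a
  simp only [extraC, mon5_eq, extraList, List.mem_cons, List.not_mem_nil, or_false,
    Set.mem_insert_iff, Set.mem_singleton_iff, Set.mem_ofPred_eq, exists_eq_or_imp,
    exists_eq_left]

theorem mem_dedup (l : List ℕ) (seen n : ℕ) :
    n ∈ dedup l seen ↔ n ∈ l ∧ seen.testBit n = false := by
  induction l generalizing seen with
  | nil => simp [dedup]
  | cons m l ih =>
    rw [dedup]
    split_ifs with h
    · rw [ih, List.mem_cons]
      constructor
      · exact fun h' => ⟨Or.inr h'.1, h'.2⟩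
      · rintro ⟨rfl | h', h2⟩
        · simp [h] at h2
        · exact ⟨h', h2⟩
    · rw [List.mem_cons, force_eq, ih, List.mem_cons, Nat.testBit_or, Nat.one_shiftLeft,
        Nat.testBit_two_pow, Bool.or_eq_false_iff, decide_eq_false_iff_not]
      by_cases hmn : n = m
      · subst hmn
        simpa using h
      · simp [hmn, Ne.symm hmn]

theorem basisMonomials_eq :
    basisMonomials = Set.range fun i : Fin basisCodes.length => listExp 5 (codeExps basisCodes[i]) := by
  have hmem : ∀ n, n ∈ basisCodes ↔ ∃ l ∈ phiPlusList ++ extraList, codeOf l = n := by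
    intro n
    rw [basisCodes, mem_dedup, List.mem_map]
    simp
  rw [basisMonomials, phiPlus_eq, extraC_eq]
  ext a
  rw [Set.mem_union, Set.mem_range]
  constructor
  · intro h
    have : ∃ l ∈ phiPlusList ++ extraList, a = listExp 5 l := by
      rcases h with ⟨l, hl, rfl⟩ | ⟨l, hl, rfl⟩
      · exact ⟨l, List.mem_append_left _ hl, rfl⟩
      · exact ⟨l, List.mem_append_right _ hl, rfl⟩
    obtain ⟨l, hl, rfl⟩ := this
    obtain ⟨i, hi, hil⟩ := List.mem_iff_getElem.mp ((hmem _).mpr ⟨l, hl, rfl⟩)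
    refine ⟨⟨i, hi⟩, ?_⟩
    change listExp 5 (codeExps basisCodes[i]) = _
    rw [hil, codeExps_codeOf l hl]
  · rintro ⟨i, rfl⟩
    obtain ⟨l, hl, h⟩ := (hmem _).mp (List.getElem_mem i.2)
    rw [Fin.getElem_fin, ← h, codeExps_codeOf l hl]
    rcases List.mem_append.mp hl with hl | hl
    · exact Or.inl ⟨l, hl, rfl⟩
    · exact Or.inr ⟨l, hl, rfl⟩

end HitProblem

/-! ### Passage to the subspaces of $QP_5$ and to the quotient $QP_5(\bar\omega)$. -/

namespace HitProblem

/-! ### The quotient spaces -/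

theorem PLT_le_hit (k : ℕ) : PLT k (omegaBar 5 3) ≤ hit k := by
  refine Submodule.span_le.mpr ?_
  rintro _ ⟨a, ⟨⟨hd, -⟩, hlt⟩, rfl⟩
  exact toPoly_mem_hit_of_weight_lt (hd.trans weightDegree_omegaBar) hlt

theorem degree_of_weight {a : Mon 5} (ha : weight a = omegaBar 5 3) : a.degree = 28 := by
  obtain ⟨o₀, o₁, x, y, d, -, h⟩ := exists_term ha
  have hom : (term o₀ o₁ x y d).IsHomogeneous 28 := by
    have := (isHomogeneous_varProd (allBut o₀)).mul
      (((isHomogeneous_varProd (allBut o₁)).mul ((isHomogeneous_top x y d).pow 2)).pow 2)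
    rwa [card_allBut, card_allBut] at this
  rw [← h] at hom
  refine (isHomogeneous_toPoly a).inj_right hom ?_
  rw [toPoly, Ne, MvPolynomial.monomial_eq_zero]
  exact one_ne_zero

theorem mem_monLE {a : Mon 5} (ha : weight a = omegaBar 5 3) : a ∈ monLE 5 (omegaBar 5 3) :=
  ⟨(degree_of_weight ha).trans weightDegree_omegaBar.symm, ha ▸ le_rfl⟩

theorem plusProj_mem {f : P 5} (hf : f ∈ PLE 5 (omegaBar 5 3)) :
    plusProj 5 f ∈ hit 5 ⊔ basisSpan := by
  induction hf using Submodule.span_induction with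
  | mem x hx =>
    obtain ⟨a, ⟨hd, hle⟩, rfl⟩ := hx
    rcases hle.lt_or_eq with hlt | heq
    · exact plusProj_add_mem (toPoly_mem_hit_of_weight_lt (hd.trans weightDegree_omegaBar) hlt)
    · obtain ⟨o₀, o₁, x, y, d, -, h⟩ := exists_term (toLex.injective heq)
      rw [h]
      exact plusProj_term_mem _ _ _ _ _
  | zero =>
    rw [map_zero]
    exact zero_mem _
  | add x y _ _ hx hy =>
    rw [map_add]
    exact add_mem hx hy
  | smul r x _ hx =>
    rw [map_smul]
    exact Submodule.smul_mem _ _ hx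

/-- Well-founded descent on exponent vectors: an inadmissible monomial is replaced by smaller ones,
of which those of smaller weight are hit and the others keep the weight. -/
theorem mkQ_toPoly_mem_QPSub (a : Mon 5) (ha : weight a = omegaBar 5 3) :
    (hit 5).mkQ (toPoly a) ∈ QPSub 5 (omegaBar 5 3) := by
  have key : ∀ c : Lex (Mon 5), weight (ofLex c) = omegaBar 5 3 →
      (hit 5).mkQ (toPoly (ofLex c)) ∈ QPSub 5 (omegaBar 5 3) := by
    intro c
    induction c using WellFoundedLT.induction with
    | ind c ih =>
      intro hc
      by_cases hadm : Admissible (ofLex c)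
      · exact Submodule.subset_span ⟨_, hadm, hc, rfl⟩
      · obtain ⟨Y, hY, hhit⟩ := not_not.mp hadm
        have : (hit 5).mkQ (toPoly (ofLex c)) = ∑ b ∈ Y, (hit 5).mkQ (toPoly b) := by
          rw [← map_sum, ← sub_eq_zero, ← map_sub]
          exact (Submodule.Quotient.mk_eq_zero _).mpr hhit
        rw [this]
        refine sum_mem fun b hb => ?_
        obtain ⟨hd, hlt | ⟨hw, hlt⟩⟩ := hY b hb
        · have : (hit 5).mkQ (toPoly b) = 0 := (Submodule.Quotient.mk_eq_zero _).mpr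
            (toPoly_mem_hit_of_weight_lt (hd.trans (degree_of_weight hc)) (hc ▸ hlt))
          rw [this]
          exact zero_mem _
        · exact ih (toLex b) hlt (hw.trans hc)
  exact key (toLex a) ha

theorem basisMonomials_mem {a : Mon 5} (ha : a ∈ basisMonomials) :
    weight a = omegaBar 5 3 ∧ ∀ j, 0 < a j := by
  rw [basisMonomials_eq] at ha
  obtain ⟨i, rfl⟩ := ha
  exact ⟨weight_codeExps (List.getElem_mem i.2), codeExps_pos (List.getElem_mem i.2)⟩

theorem basisSpan_eq : basisSpan = Submodule.span (ZMod 2) (toPoly '' basisMonomials) := by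
  rw [basisSpan, basisMonomials_eq, ← Set.range_comp]
  congr 1
  ext f
  constructor
  · rintro ⟨n, hn, rfl⟩
    obtain ⟨i, hi, rfl⟩ := List.mem_iff_getElem.mp hn
    exact ⟨⟨i, hi⟩, toPoly_codeExps _⟩
  · rintro ⟨i, rfl⟩
    exact ⟨basisCodes[i], List.getElem_mem i.2, toPoly_codeExps _⟩

theorem linearIndependent_comp_basis : LinearIndependent (ZMod 2)
    ((fun a : Mon 5 => (hit 5).mkQ (toPoly a)) ∘
      fun i : Fin basisCodes.length => listExp 5 (codeExps basisCodes[i])) := by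
  have h := linearIndependent_basisCodes
  simp only [← toPoly_codeExps] at h
  exact h

/-- Independent families are injective, so the 355 codes give distinct monomials. -/
theorem basisMonomials_ncard : basisMonomials.ncard = 355 := by
  rw [basisMonomials_eq, ← Set.image_univ,
    Set.ncard_image_of_injective _ linearIndependent_comp_basis.injective.of_comp,
    Set.ncard_univ, Nat.card_eq_fintype_card, Fintype.card_fin, basisCodes_check.1]

theorem linearIndependent_basisMonomials : LinearIndependent (ZMod 2)
    fun a : basisMonomials => (hit 5).mkQ (toPoly (a : Mon 5)) := by
  have h := linearIndependent_comp_basis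
  have hinj := h.injective.of_comp
  have aux : ∀ S : Set (Mon 5),
      S = Set.range (fun i : Fin basisCodes.length => listExp 5 (codeExps basisCodes[i])) →
      LinearIndependent (ZMod 2) fun a : S => (hit 5).mkQ (toPoly (a : Mon 5)) := by
    rintro S rfl
    exact (linearIndependent_equiv (Equiv.ofInjective _ hinj)).mp h
  exact aux _ basisMonomials_eq

theorem span_basisMonomials : Submodule.span (ZMod 2)
    (Set.range fun a : basisMonomials => (hit 5).mkQ (toPoly (a : Mon 5))) =
      QPPlusSub 5 (omegaBar 5 3) := by
  have e : Submodule.span (ZMod 2)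
      (Set.range fun a : basisMonomials => (hit 5).mkQ (toPoly (a : Mon 5))) =
        basisSpan.map (hit 5).mkQ := by
    rw [basisSpan_eq, Submodule.map_span, ← Set.image_comp, Set.image_eq_range]
    rfl
  refine le_antisymm (Submodule.span_le.mpr ?_) ?_
  · rintro _ ⟨a, rfl⟩
    obtain ⟨hw, hpos⟩ := basisMonomials_mem a.2
    exact ⟨mkQ_toPoly_mem_QPSub _ hw,
      Submodule.mem_map_of_mem (Submodule.subset_span ⟨_, hpos, rfl⟩)⟩
  · rintro q ⟨hq, g, hg, rfl⟩
    have hle : QPSub 5 (omegaBar 5 3) ≤ (PLE 5 (omegaBar 5 3)).map (hit 5).mkQ := by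
      refine Submodule.span_le.mpr ?_
      rintro _ ⟨a, -, hw, rfl⟩
      exact Submodule.mem_map_of_mem (Submodule.subset_span ⟨a, mem_monLE hw, rfl⟩)
    obtain ⟨f, hf, hfg⟩ := hle hq
    -- The class $q$ has a representative $f$ in $P_5(\bar\omega)$ and a representative $g$ in
    -- $P_5^+$. Projecting the hit difference fixes $g$ and replaces $f$ by its positive part, which
    -- lies in the span of $S$ modulo hit polynomials.
    have hsub : f - g ∈ hit 5 := by
      rw [← Submodule.Quotient.mk_eq_zero, ← Submodule.mkQ_apply, map_sub, hfg, sub_self]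
    have h1 := plusProj_mem_hit hsub
    rw [map_sub, plusProj_of_mem hg] at h1
    obtain ⟨y, hy, s, hs, hys⟩ := Submodule.mem_sup.mp (plusProj_mem hf)
    rw [e]
    refine ⟨s, hs, ?_⟩
    rw [← sub_eq_zero, ← map_sub]
    refine (Submodule.Quotient.mk_eq_zero _).mpr ?_
    rw [show s - g = (plusProj 5 f - g) - y by rw [← hys]; abel]
    exact sub_mem h1 hy

theorem toPoly_mem_PLE (a : basisMonomials) :
    toPoly (a : Mon 5) ∈ PLE 5 (omegaBar 5 3) :=
  Submodule.subset_span ⟨_, mem_monLE (basisMonomials_mem a.2).1, rfl⟩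

/-- Lower weights being hit, the map to $QP_5$ factors through $QP_5(\bar\omega)$, and independence
in the target implies independence in the source. -/
theorem QDenom_le_ker : QDenom 5 (omegaBar 5 3) ≤
    LinearMap.ker ((hit 5).mkQ.comp (PLE 5 (omegaBar 5 3)).subtype) := by
  intro x hx
  rw [LinearMap.mem_ker]
  refine (Submodule.Quotient.mk_eq_zero _).mpr ?_
  exact sup_le inf_le_left (PLT_le_hit 5) hx

theorem linearIndependent_QPQuot : LinearIndependent (ZMod 2)
    fun a : basisMonomials => (QDenom 5 (omegaBar 5 3)).mkQ
      ⟨toPoly (a : Mon 5), toPoly_mem_PLE a⟩ :=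
  LinearIndependent.of_comp ((QDenom 5 (omegaBar 5 3)).liftQ _ QDenom_le_ker)
    linearIndependent_basisMonomials

theorem span_QPQuot : Submodule.span (ZMod 2)
    (Set.range fun a : basisMonomials => (QDenom 5 (omegaBar 5 3)).mkQ
      ⟨toPoly (a : Mon 5), toPoly_mem_PLE a⟩) = QPQuotPlus 5 (omegaBar 5 3) := by
  refine le_antisymm (Submodule.span_le.mpr ?_) ?_
  · rintro _ ⟨a, rfl⟩
    exact Submodule.mem_map_of_mem
      (Submodule.subset_span ⟨_, (basisMonomials_mem a.2).2, rfl⟩)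
  · rintro _ ⟨x, hx, rfl⟩
    obtain ⟨y, hy, s, hs, hys⟩ := Submodule.mem_sup.mp (plusProj_mem x.2)
    rw [plusProj_of_mem (show (x : P 5) ∈ PPlus 5 from hx)] at hys
    set T := Submodule.span (ZMod 2)
      (Set.range fun a : basisMonomials => (QDenom 5 (omegaBar 5 3)).mkQ
        ⟨toPoly (a : Mon 5), toPoly_mem_PLE a⟩) with hT
    -- The combination `s` of basis monomials is lifted into $P_5(\bar\omega)$. The difference of
    -- `x` and this lift is then both hit and in $P_5(\bar\omega)$, as the denominator requires.
    have hle : basisSpan ≤ (T.comap (QDenom 5 (omegaBar 5 3)).mkQ).map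
        (PLE 5 (omegaBar 5 3)).subtype := by
      rw [basisSpan_eq]
      refine Submodule.span_le.mpr ?_
      rintro _ ⟨a, ha, rfl⟩
      exact ⟨⟨toPoly a, toPoly_mem_PLE ⟨a, ha⟩⟩, Submodule.subset_span ⟨⟨a, ha⟩, rfl⟩, rfl⟩
    obtain ⟨s', hs', rfl⟩ := hle hs
    have : (QDenom 5 (omegaBar 5 3)).mkQ x = (QDenom 5 (omegaBar 5 3)).mkQ s' := by
      rw [← sub_eq_zero, ← map_sub]
      refine (Submodule.Quotient.mk_eq_zero _).mpr (Submodule.mem_sup_left ⟨?_, (x - s').2⟩)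
      have e : ((x - s' : PLE 5 (omegaBar 5 3)) : P 5) = y := by
        rw [Submodule.coe_sub, ← hys, Submodule.subtype_apply, add_sub_cancel_right]
      exact Set.mem_of_eq_of_mem e hy
    rw [this]
    exact hs'

end HitProblem

theorem proposition3p2p1 :
    HitProblem.basisMonomials.ncard = 355 ∧
    (LinearIndependent (ZMod 2)
        (fun a : HitProblem.basisMonomials =>
          (HitProblem.hit 5).mkQ (HitProblem.toPoly (a : HitProblem.Mon 5))) ∧
      Submodule.span (ZMod 2)
        (Set.range fun a : HitProblem.basisMonomials =>
          (HitProblem.hit 5).mkQ (HitProblem.toPoly (a : HitProblem.Mon 5))) =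
        HitProblem.QPPlusSub 5 (HitProblem.omegaBar 5 3)) ∧
    ∃ h : ∀ a : HitProblem.basisMonomials,
        HitProblem.toPoly (a : HitProblem.Mon 5) ∈ HitProblem.PLE 5 (HitProblem.omegaBar 5 3),
      LinearIndependent (ZMod 2)
        (fun a : HitProblem.basisMonomials =>
          (HitProblem.QDenom 5 (HitProblem.omegaBar 5 3)).mkQ
            ⟨HitProblem.toPoly (a : HitProblem.Mon 5), h a⟩) ∧
      Submodule.span (ZMod 2)
        (Set.range fun a : HitProblem.basisMonomials =>
          (HitProblem.QDenom 5 (HitProblem.omegaBar 5 3)).mkQ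
            ⟨HitProblem.toPoly (a : HitProblem.Mon 5), h a⟩) =
        HitProblem.QPQuotPlus 5 (HitProblem.omegaBar 5 3) :=
  ⟨HitProblem.basisMonomials_ncard,
    ⟨HitProblem.linearIndependent_basisMonomials, HitProblem.span_basisMonomials⟩,
    HitProblem.toPoly_mem_PLE, HitProblem.linearIndependent_QPQuot, HitProblem.span_QPQuot⟩
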